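/- On the region $r>0$, $0<\theta<\pi$ with coordinates $(r,\theta,\phi,\psi)$ let $V=1+\frac1r$ and let $$g=V\bigl(dr^2+r^2(d\theta^2+\sin^2\theta\,d\phi^2)\bigr)+V^{-1}(d\psi+\cos\theta\,d\phi)^2$$ be the Taub-NUT metric. Let $\tau_j$ be the Pauli matrices, $\mathbf t_j=\frac i2\tau_j$, and put $$\eta_1=-\sin\psi\,d\theta+\sin\theta\cos\psi\,d\phi,\quad \eta_2=\cos\psi\,d\theta+\sin\theta\sin\psi\,d\phi,\quad \eta_3=d\psi+\cos\theta\,d\phi,$$ $$e_0=\sqrt V\,dr,\quad e_1=r\sqrt V\,\eta_1,\quad e_2=r\sqrt V\,\eta_2,\quad e_3=\tfrac1{\sqrt V}\,\eta_3,\qquad \Sigma_i=e_0\wedge e_i+\tfrac12\varepsilon_{ijk}\,e_j\wedge e_k .$$ 1. The tetrad is orthonormal, $g=\sum_a e_a^2$, and $SU(2)$-invariant: with $h=e^{\phi\mathbf t_3}e^{\theta\mathbf t_2}e^{\psi\mathbf t_3}\in SU(2)$ one has $h^{-1}dh=\sum_j\eta_j\,\mathbf t_j$, so the $\eta_j$ are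 left-invariant one-forms. 2. There is exactly one antisymmetric matrix of one-forms $(\gamma_{ij})$ on the region (the self-dual spin connection in this gauge) with $d\Sigma_i+\gamma_{ij}\wedge\Sigma_j=0$. Let $A=\frac12\varepsilon_{ijk}\gamma_{jk}\otimes\mathbf t_i$. Its contraction with $\partial/\partial\phi$ is $A_\phi=\sum_j f_j(r)\,n_j\,\mathbf t_j$, where $\mathbf n=(\sin\theta\cos\psi,\sin\theta\sin\psi,\cos\theta)$ and $$f_1=f_2=-\frac{r}{r+1},\qquad f_3=\frac{r(r+2)}{(r+1)^2}.$$ Its holonomy $\mathcal P\exp\bigl(-\int_0^{2\pi}A_\phi\,d\phi\bigr)$, that is, $\Psi(2\pi)$ for the solution on $0\le\phi\le2\pi$ of $\partial_\phi\Psi=-A_\phi\Psi$, $\Psi(0)=\mathbf 1$, is the Skyrme field $$U(r,\theta,\psi)=\exp\Bigl(-i\pi\sum_{j=1}^3 f_j(r)\,n_j\,\tau_j\Bigr).$$ 3. $U$ takes values in $SU(2)$ and is smooth on $\mathcal B=\{(r,\theta,\psi): r>0,\ 0<\theta<\pi,\ 0<\psi<4\pi\}$, the three-form $\mathrm{Tr}\bigl((U^{-1}dU)^3\bigr)$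 is integrable on $\mathcal B$, and, with $\mathcal B$ oriented by $dr\wedge d\theta\wedge d\psi$, the topological degree of $U$ is $$D=-\frac1{24\pi^2}\int_{\mathcal B}\mathrm{Tr}\bigl((U^{-1}dU)^3\bigr)=2 .$$ -/

import Mathlib

namespace TaubNUT

noncomputable section

/-! ### Coordinates and differential forms

Coordinates on the Taub-NUT manifold are `x = (r, θ, φ, ψ)`; the space of orbits of `∂/∂φ` has the
coordinates `q = (r, θ, ψ)`. -/

/-- The coordinate space of `(r, θ, φ, ψ)`. -/
abbrev Coord4 : Type := Fin 4 → ℝ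

/-- The coordinate space of `(r, θ, ψ)`. -/
abbrev Coord3 : Type := Fin 3 → ℝ

/-- The domain `r > 0`, `0 < θ < π` of the coordinates `(r, θ, φ, ψ)`. -/
def chart : Set Coord4 := {x | 0 < x 0 ∧ 0 < x 1 ∧ x 1 < Real.pi}

/-- The coordinate domain `r > 0`, `0 < θ < π`, `0 < ψ < 4π` of the space of orbits. -/
def orbitSpace : Set Coord3 :=
  {q | 0 < q 0 ∧ (0 < q 1 ∧ q 1 < Real.pi) ∧ 0 < q 2 ∧ q 2 < 4 * Real.pi}

/-- A one-form at a point. -/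
abbrev Covector : Type := Coord4 →L[ℝ] ℝ

/-- The coordinate differentials `dr, dθ, dφ, dψ`. -/
def dx (k : Fin 4) : Covector := ContinuousLinearMap.proj k

/-- The coordinate vector fields. -/
def partialVec {n : ℕ} (k : Fin n) : Fin n → ℝ := Pi.single k 1

/-- A one-form as an alternating form of degree one. -/
def toForm (α : Covector) : Coord4 [⋀^Fin 1]→L[ℝ] ℝ :=
  ContinuousAlternatingMap.ofSubsingleton ℝ Coord4 ℝ (0 : Fin 1) α

/-- The wedge product of a one-form with an `n`-form,
`(α ∧ ω)(v₀, …, vₙ) = ∑ᵢ (-1)ⁱ α(vᵢ) ω(v₀, …, v̂ᵢ, …, vₙ)`. -/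
def wedge {n : ℕ} (α : Covector) (ω : Coord4 [⋀^Fin n]→L[ℝ] ℝ) :
    Coord4 [⋀^Fin (n + 1)]→L[ℝ] ℝ :=
  ContinuousAlternatingMap.alternatizeUncurryFin (ContinuousLinearMap.smulRight α ω)

/-- The totally antisymmetric symbol on three indices, `ε₀₁₂ = 1`. -/
def levi (i j k : Fin 3) : ℝ :=
  (((j : ℕ) : ℝ) - ((i : ℕ) : ℝ)) * (((k : ℕ) : ℝ) - ((i : ℕ) : ℝ))
    * (((k : ℕ) : ℝ) - ((j : ℕ) : ℝ)) / 2

/-! ### The Taub-NUT metric and its invariant tetrad -/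

/-- The potential `V = 1 + 1/r`. -/
def potV (x : Coord4) : ℝ := 1 + 1 / x 0

/-- The quadratic form of the Taub-NUT metric
`V (dr² + r² (dθ² + sin² θ dφ²)) + V⁻¹ (dψ + cos θ dφ)²`. -/
def metric (x v : Coord4) : ℝ :=
  potV x * (v 0 ^ 2 + x 0 ^ 2 * (v 1 ^ 2 + Real.sin (x 1) ^ 2 * v 2 ^ 2))
    + (potV x)⁻¹ * (v 3 + Real.cos (x 1) * v 2) ^ 2

/-- The one-forms `η₁, η₂, η₃`. -/
def eta (j : Fin 3) (x : Coord4) : Covector :=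
  ![-Real.sin (x 3) • dx 1 + (Real.sin (x 1) * Real.cos (x 3)) • dx 2,
    Real.cos (x 3) • dx 1 + (Real.sin (x 1) * Real.sin (x 3)) • dx 2,
    dx 3 + Real.cos (x 1) • dx 2] j

/-- The tetrad `e₀ = √V dr`, `e₁ = r √V η₁`, `e₂ = r √V η₂`, `e₃ = η₃ / √V`. -/
def tetrad (a : Fin 4) (x : Coord4) : Covector :=
  ![Real.sqrt (potV x) • dx 0,
    (x 0 * Real.sqrt (potV x)) • eta 0 x,
    (x 0 * Real.sqrt (potV x)) • eta 1 x,
    (1 / Real.sqrt (potV x)) • eta 2 x] a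

/-- The self-dual two-forms `Σᵢ = e₀ ∧ eᵢ + ½ ∑ⱼₖ εᵢⱼₖ eⱼ ∧ eₖ` of the tetrad. -/
def selfDualForm (i : Fin 3) (x : Coord4) : Coord4 [⋀^Fin 2]→L[ℝ] ℝ :=
  wedge (tetrad 0 x) (toForm (tetrad i.succ x))
    + (1 / 2 : ℝ) • ∑ j : Fin 3, ∑ k : Fin 3,
        levi i j k • wedge (tetrad j.succ x) (toForm (tetrad k.succ x))

/-- `γ` is the matrix of coefficients, in the given tetrad, of the self-dual spin connection:
`γᵢⱼ = -γⱼᵢ` and `dΣᵢ + ∑ⱼ γᵢⱼ ∧ Σⱼ = 0`. -/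
structure IsSelfDualSpinConnection (γ : Fin 3 → Fin 3 → Coord4 → Covector) : Prop where
  antisymm : ∀ x ∈ chart, ∀ i j, γ i j x = -γ j i x
  cartan : ∀ x ∈ chart, ∀ i,
    extDeriv (selfDualForm i) x + ∑ j, wedge (γ i j x) (selfDualForm j x) = 0

/-! ### The gauge potential and its holonomy -/

/-- The Pauli matrices. -/
def pauli (j : Fin 3) : Matrix (Fin 2) (Fin 2) ℂ :=
  ![!![0, 1; 1, 0], !![0, -Complex.I; Complex.I, 0], !![1, 0; 0, -1]] j

/-- The generators `tⱼ = (i/2) τⱼ` of `su(2)`. -/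
def gen (j : Fin 3) : Matrix (Fin 2) (Fin 2) ℂ := (Complex.I / 2) • pauli j

/-- The components `Aᵢ = ½ ∑ⱼₖ εᵢⱼₖ γⱼₖ` of the Yang-Mills potential. -/
def potentialComponent (γ : Fin 3 → Fin 3 → Coord4 → Covector) (i : Fin 3) (x : Coord4) :
    Covector :=
  (1 / 2 : ℝ) • ∑ j, ∑ k, levi i j k • γ j k x

/-- The Yang-Mills potential `A = ∑ᵢ Aᵢ ⊗ tᵢ`, evaluated at `x` on the vector `v`. -/
def potential (γ : Fin 3 → Fin 3 → Coord4 → Covector) (x v : Coord4) :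
    Matrix (Fin 2) (Fin 2) ℂ :=
  ∑ i, ((potentialComponent γ i x v : ℝ) : ℂ) • gen i

/-- The Euler angle parametrisation `exp(φ t₃) exp(θ t₂) exp(ψ t₃)` of `SU(2)`. -/
def eulerMap (x : Coord4) : Matrix (Fin 2) (Fin 2) ℂ :=
  NormedSpace.exp (((x 2 : ℝ) : ℂ) • gen 2) * NormedSpace.exp (((x 1 : ℝ) : ℂ) • gen 1)
    * NormedSpace.exp (((x 3 : ℝ) : ℂ) • gen 2)

/-- The point with coordinate `φ = s` on the orbit labelled by `q = (r, θ, ψ)`. -/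
def orbitPoint (q : Coord3) (s : ℝ) : Coord4 := ![q 0, q 1, s, q 2]

/-- `Ψ` is the parallel transport of `A` along the orbit `q` of `∂/∂φ`, `0 ≤ φ ≤ 2π`:
`∂Ψ/∂φ = -A_φ Ψ` and `Ψ(0) = 1` (entry by entry). -/
structure IsTransport (A : Coord4 → Coord4 → Matrix (Fin 2) (Fin 2) ℂ) (q : Coord3)
    (Ψ : ℝ → Matrix (Fin 2) (Fin 2) ℂ) : Prop where
  init : Ψ 0 = 1
  ode : ∀ s ∈ Set.Icc 0 (2 * Real.pi), ∀ a b,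
    HasDerivWithinAt (fun t => Ψ t a b)
      ((-(A (orbitPoint q s) (partialVec 2)) * Ψ s) a b) (Set.Icc 0 (2 * Real.pi)) s

/-- `W = P exp(-∫₀^{2π} A_φ dφ)` along the orbit `q`. -/
def IsHolonomy (A : Coord4 → Coord4 → Matrix (Fin 2) (Fin 2) ℂ) (q : Coord3)
    (W : Matrix (Fin 2) (Fin 2) ℂ) : Prop :=
  (∃ Ψ, IsTransport A q Ψ) ∧ ∀ Ψ, IsTransport A q Ψ → Ψ (2 * Real.pi) = W

/-! ### The Skyrme field and its topological degree -/

/-- The functions `f₁ = f₂ = -r/(r+1)` and `f₃ = r(r+2)/(r+1)²`. -/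
def profile (j : Fin 3) (r : ℝ) : ℝ :=
  ![-r / (r + 1), -r / (r + 1), r * (r + 2) / (r + 1) ^ 2] j

/-- The unit vector `n = (sin θ cos ψ, sin θ sin ψ, cos θ)`. -/
def unitVec (j : Fin 3) (θ ψ : ℝ) : ℝ :=
  ![Real.sin θ * Real.cos ψ, Real.sin θ * Real.sin ψ, Real.cos θ] j

/-- The Taub-NUT Skyrme field `U = exp(-iπ ∑ⱼ fⱼ(r) nⱼ(θ, ψ) τⱼ)`. -/
def skyrmeField (q : Coord3) : Matrix (Fin 2) (Fin 2) ℂ :=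
  NormedSpace.exp ((-(Complex.I * (Real.pi : ℂ))) •
    ∑ j, ((profile j (q 0) * unitVec j (q 1) (q 2) : ℝ) : ℂ) • pauli j)

/-- The coefficient `U⁻¹ ∂ₖU` of `U⁻¹ dU`. -/
def leftCurrent (U : Coord3 → Matrix (Fin 2) (Fin 2) ℂ) (k : Fin 3) (q : Coord3) :
    Matrix (Fin 2) (Fin 2) ℂ :=
  (U q)⁻¹ * Matrix.of fun a b => lineDeriv ℝ (fun p => U p a b) q (partialVec k)

/-- The coefficient of `dr ∧ dθ ∧ dψ` in the three-form `Tr((U⁻¹ dU)³)`. -/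
def traceCube (U : Coord3 → Matrix (Fin 2) (Fin 2) ℂ) (q : Coord3) : ℂ :=
  ∑ σ : Equiv.Perm (Fin 3), ((Equiv.Perm.sign σ : ℤ) : ℂ) *
    Matrix.trace (leftCurrent U (σ 0) q * leftCurrent U (σ 1) q * leftCurrent U (σ 2) q)

/-- The degree `D = -(1/24π²) ∫ Tr((U⁻¹ dU)³)` over the space of orbits, oriented by
`dr ∧ dθ ∧ dψ`. -/
def degree (U : Coord3 → Matrix (Fin 2) (Fin 2) ℂ) : ℂ :=
  -(1 / (24 * (Real.pi : ℂ) ^ 2)) * ∫ q in orbitSpace, traceCube U q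

end

end TaubNUT

namespace TaubNUT

/-!
In terms of the Maurer-Cartan forms, `Σᵢ` is a combination of `dr ∧ ηᵢ` and `ηᵢ₊₁ ∧ ηᵢ₊₂` with
coefficients depending on `r` only, so the structure equation is solved by
`γᵢⱼ = ∑ₖ εᵢⱼₖ fₖ ηₖ` with the functions `fₖ` read off from the coefficients of
`dr ∧ ηᵢ₊₁ ∧ ηᵢ₊₂`. Self-dual two-forms of a coframe determine the connection: for the difference
of two solutions, the structure equation evaluated on triples of the dual frame is a linear system
with only the zero solution. Since `A_φ` is constant along the orbits, the holonomy is an ordinary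
exponential.

For the degree, identify `SU(2)` with the unit quaternions. Then `U = exp(πF)` with the imaginary
quaternion `F = (f₁ n₁, f₂ n₂, f₃ n₃)`, and `Tr((U⁻¹ dU)³)` is `-12` times the volume form of the
three-sphere pulled back by `U`, that is `(sin ρ / ρ)²` times the Jacobian of `πF`, where
`ρ = π|F|`. This form is exact: it is the exterior derivative of a primitive in `ρ` times the area
form pulled back by `F / |F|`. In the coordinate `s = r / (r + 1)` everything extends smoothly to a
compact box, and in the divergence theorem only the face `r = ∞` contributes.
-/

open Matrix MeasureTheory Set
open scoped Real Quaternion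

/-! ### Exponentials of the generators and Euler angles -/

theorem exp_smul_of_mul_self_eq_neg_one {A : Type*} [NormedRing A] [NormedAlgebra ℝ A] {J : A}
    (hJ : J * J = -1) (t : ℝ) :
    NormedSpace.exp (t • J) = Real.cos t • (1 : A) + Real.sin t • J := by
  let _ : NormedAlgebra ℚ ℂ := .restrictScalars ℚ ℝ ℂ
  let _ : NormedAlgebra ℚ A := .restrictScalars ℚ ℝ A
  have lift_apply (z : ℂ) : Complex.liftAux J hJ z = z.re • (1 : A) + z.im • J := by
    rw [Complex.liftAux_apply, Algebra.algebraMap_eq_smul_one]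
  have hcont : Continuous (Complex.liftAux J hJ) := by
    simp_rw [funext lift_apply]
    fun_prop
  have := NormedSpace.map_exp (Complex.liftAux J hJ) hcont (t * Complex.I)
  simpa [lift_apply, ← Complex.exp_eq_exp_ℂ, Complex.exp_ofReal_mul_I_re,
    Complex.exp_ofReal_mul_I_im] using this.symm

theorem pauli_mul_self (i : Fin 3) : pauli i * pauli i = 1 := by
  match i with
  | 0 | 1 | 2 => simp [pauli, one_fin_two]

theorem pauli_mul_pauli_add_one (i : Fin 3) :
    pauli i * pauli (i + 1) = Complex.I • pauli (i + 2) := by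
  match i with
  | 0 | 1 | 2 => simp [pauli]

theorem pauli_add_one_mul_pauli (i : Fin 3) :
    pauli (i + 1) * pauli i = -Complex.I • pauli (i + 2) := by
  match i with
  | 0 | 1 | 2 => simp [pauli]

theorem gen_mul_self (i : Fin 3) : gen i * gen i = -(1 / 4 : ℝ) • 1 := by
  rw [gen, smul_mul_smul_comm, pauli_mul_self, ← Complex.coe_smul]
  congr 1
  push_cast
  linear_combination Complex.I_sq / 4

theorem gen_mul_gen_add_one (i : Fin 3) : gen i * gen (i + 1) = -(1 / 2 : ℝ) • gen (i + 2) := by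
  rw [gen, gen, gen, smul_mul_smul_comm, pauli_mul_pauli_add_one, ← Complex.coe_smul, smul_smul,
    smul_smul]
  congr 1
  push_cast
  linear_combination Complex.I / 4 * Complex.I_sq

theorem gen_add_one_mul_gen (i : Fin 3) : gen (i + 1) * gen i = (1 / 2 : ℝ) • gen (i + 2) := by
  rw [gen, gen, gen, smul_mul_smul_comm, pauli_add_one_mul_pauli, ← Complex.coe_smul, smul_smul,
    smul_smul]
  congr 1
  push_cast
  linear_combination -Complex.I / 4 * Complex.I_sq

open scoped Matrix.Norms.Operator in
theorem exp_smul_gen (t : ℝ) (i : Fin 3) :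
    NormedSpace.exp (t • gen i)
      = Real.cos (t / 2) • (1 : Matrix (Fin 2) (Fin 2) ℂ) + (2 * Real.sin (t / 2)) • gen i := by
  have hJ : ((2 : ℝ) • gen i) * ((2 : ℝ) • gen i) = -1 := by
    rw [smul_mul_smul_comm, gen_mul_self]
    module
  calc NormedSpace.exp (t • gen i) = NormedSpace.exp ((t / 2) • (2 : ℝ) • gen i) := by
        rw [smul_smul, div_mul_cancel₀ t two_ne_zero]
    _ = _ := exp_smul_of_mul_self_eq_neg_one hJ (t / 2)
    _ = _ := by rw [smul_smul, mul_comm]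

theorem gen_add_one_mul_exp_smul_gen (t : ℝ) (i : Fin 3) :
    gen (i + 1) * NormedSpace.exp (t • gen i)
      = NormedSpace.exp (t • gen i) * (Real.cos t • gen (i + 1) + Real.sin t • gen (i + 2)) := by
  have hmul : gen i * gen (i + 2) = (1 / 2 : ℝ) • gen (i + 1) := by
    simpa [add_assoc] using gen_add_one_mul_gen (i + 2)
  have hcos : Real.cos t = Real.cos (t / 2) ^ 2 - Real.sin (t / 2) ^ 2 := by
    rw [← Real.cos_two_mul', mul_div_cancel₀ t two_ne_zero]
  have hsin : Real.sin t = 2 * Real.sin (t / 2) * Real.cos (t / 2) := by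
    rw [← Real.sin_two_mul, mul_div_cancel₀ t two_ne_zero]
  have hsq := Real.sin_sq_add_cos_sq (t / 2)
  simp only [exp_smul_gen, mul_add, add_mul, mul_smul_comm, smul_mul_assoc,
    one_mul, mul_one, gen_mul_gen_add_one, gen_add_one_mul_gen, hmul, hcos, hsin]
  match_scalars
  · linear_combination -Real.cos (t / 2) * hsq
  · linear_combination -Real.sin (t / 2) * hsq

theorem gen_mul_exp_smul_gen_add_one (t : ℝ) (i : Fin 3) :
    gen i * NormedSpace.exp (t • gen (i + 1))
      = NormedSpace.exp (t • gen (i + 1)) * (Real.cos t • gen i - Real.sin t • gen (i + 2)) := by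
  have hmul : gen (i + 1) * gen (i + 2) = -(1 / 2 : ℝ) • gen i := by
    simpa [add_assoc] using gen_mul_gen_add_one (i + 1)
  have hcos : Real.cos t = Real.cos (t / 2) ^ 2 - Real.sin (t / 2) ^ 2 := by
    rw [← Real.cos_two_mul', mul_div_cancel₀ t two_ne_zero]
  have hsin : Real.sin t = 2 * Real.sin (t / 2) * Real.cos (t / 2) := by
    rw [← Real.sin_two_mul, mul_div_cancel₀ t two_ne_zero]
  have hsq := Real.sin_sq_add_cos_sq (t / 2)
  simp only [exp_smul_gen, mul_add, add_mul, mul_sub, mul_smul_comm,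
    smul_mul_assoc, one_mul, mul_one, gen_mul_gen_add_one, gen_add_one_mul_gen, hmul, hcos, hsin]
  match_scalars
  · linear_combination -Real.cos (t / 2) * hsq
  · linear_combination Real.sin (t / 2) * hsq

theorem eulerMap_eq (x : Coord4) :
    eulerMap x = NormedSpace.exp (x 2 • gen 2) * NormedSpace.exp (x 1 • gen 1)
      * NormedSpace.exp (x 3 • gen 2) := by
  simp only [eulerMap, Complex.coe_smul]

theorem sum_eta_smul_gen (x v : Coord4) :
    ∑ j, ((eta j x v : ℝ) : ℂ) • gen j
      = v 2 • (Real.cos (x 1) • gen 2 + Real.sin (x 1) • (Real.cos (x 3) • gen 0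
        + Real.sin (x 3) • gen 1)) + v 1 • (Real.cos (x 3) • gen 1 - Real.sin (x 3) • gen 0)
        + v 3 • gen 2 := by
  simp only [Complex.coe_smul, Fin.sum_univ_three, eta, dx, cons_val, cons_val_zero, cons_val_one,
    _root_.add_apply, _root_.smul_apply, ContinuousLinearMap.proj_apply, smul_eq_mul]
  module

theorem gen_two_mul_exp_mul_exp (θ ψ : ℝ) :
    gen 2 * (NormedSpace.exp (θ • gen 1) * NormedSpace.exp (ψ • gen 2))
      = NormedSpace.exp (θ • gen 1) * NormedSpace.exp (ψ • gen 2)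
        * (Real.cos θ • gen 2 + Real.sin θ • (Real.cos ψ • gen 0 + Real.sin ψ • gen 1)) := by
  have h₂₁ : gen 2 * NormedSpace.exp (θ • gen 1)
      = NormedSpace.exp (θ • gen 1) * (Real.cos θ • gen 2 + Real.sin θ • gen 0) :=
    gen_add_one_mul_exp_smul_gen θ 1
  have h₀₂ : gen 0 * NormedSpace.exp (ψ • gen 2)
      = NormedSpace.exp (ψ • gen 2) * (Real.cos ψ • gen 0 + Real.sin ψ • gen 1) :=
    gen_add_one_mul_exp_smul_gen ψ 2
  have h₂₂ : gen 2 * NormedSpace.exp (ψ • gen 2) = NormedSpace.exp (ψ • gen 2) * gen 2 :=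
    ((Commute.refl (gen 2)).smul_right ψ).exp_right
  rw [← mul_assoc, h₂₁]
  simp only [mul_assoc, add_mul, smul_mul_assoc, h₂₂, h₀₂, mul_add, mul_smul_comm]

theorem hasDerivAt_entry {m n : Type*} [Finite m] [Finite n] {M : ℝ → Matrix m n ℂ}
    {M' : Matrix m n ℂ} {s : ℝ} (h : HasDerivAt M M' s) (a : m) (b : n) :
    HasDerivAt (fun t => M t a b) (M' a b) s := by
  let _ := Fintype.ofFinite m
  let _ := Fintype.ofFinite n
  exact hasDerivAt_pi.1 (hasDerivAt_pi.1 h a) b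

open scoped Matrix.Norms.Operator in
theorem hasDerivAt_exp_smul_gen_line (x v : Coord4) (k : Fin 4) (i : Fin 3) :
    HasDerivAt (fun s : ℝ => NormedSpace.exp ((x + s • v) k • gen i))
      (v k • (NormedSpace.exp ((x + (0 : ℝ) • v) k • gen i) * gen i)) 0 := by
  have hk : HasDerivAt (fun s : ℝ => (x + s • v) k) (v k) 0 := by
    simpa using ((hasDerivAt_id (0 : ℝ)).mul_const (v k)).const_add (x k)
  exact (hasDerivAt_exp_smul_const (𝕂 := ℝ) (gen i) ((x + (0 : ℝ) • v) k)).scomp (0 : ℝ) hk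

open scoped Matrix.Norms.Operator in
theorem hasDerivAt_eulerMap (x v : Coord4) (a b : Fin 2) :
    HasDerivAt (fun s : ℝ => eulerMap (x + s • v) a b)
      ((eulerMap x * ∑ j, ((eta j x v : ℝ) : ℂ) • gen j) a b) 0 := by
  have hexp := hasDerivAt_exp_smul_gen_line x v
  have h₁₂ : gen 1 * NormedSpace.exp (x 3 • gen 2)
      = NormedSpace.exp (x 3 • gen 2) * (Real.cos (x 3) • gen 1 - Real.sin (x 3) • gen 0) :=
    gen_mul_exp_smul_gen_add_one (x 3) 1
  simp only [eulerMap_eq]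
  convert hasDerivAt_entry (((hexp 2 2).mul (hexp 1 1)).mul (hexp 3 2)) a b using 1
  · rfl
  refine congrArg (fun M : Matrix (Fin 2) (Fin 2) ℂ => M a b) ?_
  simp only [sum_eta_smul_gen, zero_smul, add_zero, Pi.mul_apply, add_mul, mul_add, smul_mul_assoc,
    mul_smul_comm, mul_assoc, gen_two_mul_exp_mul_exp, h₁₂]

/-! ### Wedge products and exterior derivatives -/

section Forms

/-- The wedge product as a continuous bilinear map. -/
noncomputable def wedgeL (n : ℕ) :
    Covector →L[ℝ] Coord4 [⋀^Fin n]→L[ℝ] ℝ →L[ℝ] Coord4 [⋀^Fin (n + 1)]→L[ℝ] ℝ :=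
  (ContinuousLinearMap.compL ℝ _ _ _
    (ContinuousAlternatingMap.alternatizeUncurryFinCLM ℝ Coord4 ℝ)).comp
    (ContinuousLinearMap.smulRightL ℝ Coord4 (Coord4 [⋀^Fin n]→L[ℝ] ℝ))

/-- `toForm` as a continuous linear map. -/
noncomputable def toFormL : Covector →L[ℝ] Coord4 [⋀^Fin 1]→L[ℝ] ℝ :=
  (ContinuousAlternatingMap.ofSubsingletonLIE (𝕜 := ℝ) (E := Coord4) (F := ℝ) (0 : Fin 1))

theorem wedge_toForm_apply (α β : Covector) (v : Fin 2 → Coord4) :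
    wedge α (toForm β) v = α (v 0) * β (v 1) - α (v 1) * β (v 0) := by
  rw [wedge, ContinuousAlternatingMap.alternatizeUncurryFin_apply]
  simp [Fin.removeNth, toForm, sub_eq_add_neg]

theorem alternatizeUncurryFin_two_apply (L : Coord4 →L[ℝ] Coord4 [⋀^Fin 2]→L[ℝ] ℝ)
    (v : Fin 3 → Coord4) :
    ContinuousAlternatingMap.alternatizeUncurryFin L v
      = L (v 0) ![v 1, v 2] - L (v 1) ![v 0, v 2] + L (v 2) ![v 0, v 1] := by
  have h₀ : Fin.removeNth 0 v = ![v 1, v 2] := by ext i; fin_cases i <;> rfl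
  have h₁ : Fin.removeNth 1 v = ![v 0, v 2] := by ext i; fin_cases i <;> rfl
  have h₂ : Fin.removeNth 2 v = ![v 0, v 1] := by ext i; fin_cases i <;> rfl
  rw [ContinuousAlternatingMap.alternatizeUncurryFin_apply]
  refine (Fin.sum_univ_three _).trans ?_
  simp [h₀, h₁, h₂, sub_eq_add_neg]

theorem wedge_two_apply (α : Covector) (ω : Coord4 [⋀^Fin 2]→L[ℝ] ℝ) (v : Fin 3 → Coord4) :
    wedge α ω v = α (v 0) * ω ![v 1, v 2] - α (v 1) * ω ![v 0, v 2] + α (v 2) * ω ![v 0, v 1] :=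
  alternatizeUncurryFin_two_apply _ v

variable {n : ℕ}

theorem wedge_zero (α : Covector) : wedge α (0 : Coord4 [⋀^Fin n]→L[ℝ] ℝ) = 0 :=
  map_zero (wedgeL n α)

theorem wedge_neg (α : Covector) (ω : Coord4 [⋀^Fin n]→L[ℝ] ℝ) : wedge α (-ω) = -wedge α ω :=
  map_neg (wedgeL n α) ω

theorem wedge_add (α : Covector) (ω ω' : Coord4 [⋀^Fin n]→L[ℝ] ℝ) :
    wedge α (ω + ω') = wedge α ω + wedge α ω' :=
  map_add (wedgeL n α) ω ω'

theorem wedge_smul (α : Covector) (c : ℝ) (ω : Coord4 [⋀^Fin n]→L[ℝ] ℝ) :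
    wedge α (c • ω) = c • wedge α ω :=
  map_smul (wedgeL n α) c ω

theorem zero_wedge (ω : Coord4 [⋀^Fin n]→L[ℝ] ℝ) : wedge 0 ω = 0 :=
  congrArg (· ω) (map_zero (wedgeL n))

theorem neg_wedge (α : Covector) (ω : Coord4 [⋀^Fin n]→L[ℝ] ℝ) : wedge (-α) ω = -wedge α ω :=
  congrArg (· ω) (map_neg (wedgeL n) α)

theorem sub_wedge (α β : Covector) (ω : Coord4 [⋀^Fin n]→L[ℝ] ℝ) :
    wedge (α - β) ω = wedge α ω - wedge β ω :=
  congrArg (· ω) (map_sub (wedgeL n) α β)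

theorem smul_wedge (c : ℝ) (α : Covector) (ω : Coord4 [⋀^Fin n]→L[ℝ] ℝ) :
    wedge (c • α) ω = c • wedge α ω :=
  congrArg (· ω) (map_smul (wedgeL n) c α)

theorem wedge_toForm_comm (α β : Covector) : wedge α (toForm β) = -wedge β (toForm α) := by
  ext v
  simp only [ContinuousAlternatingMap.neg_apply, wedge_toForm_apply]
  ring

theorem wedge_wedge_comm (α β γ : Covector) :
    wedge α (wedge β (toForm γ)) = -wedge β (wedge α (toForm γ)) := by
  ext v
  simp only [ContinuousAlternatingMap.neg_apply, wedge_two_apply, wedge_toForm_apply,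
    Matrix.cons_val_zero, Matrix.cons_val_one]
  ring

theorem wedge_wedge_self_left (α β : Covector) : wedge α (wedge α (toForm β)) = 0 := by
  ext v
  exact self_eq_neg.1 (congrArg (· v) (wedge_wedge_comm α α β))

theorem wedge_wedge_self_right (α β : Covector) : wedge α (wedge β (toForm α)) = 0 := by
  rw [wedge_toForm_comm, wedge_neg, wedge_wedge_self_left, neg_zero]

variable {α β : Coord4 → Covector} {x : Coord4}

theorem differentiableAt_wedge {ω : Coord4 → Coord4 [⋀^Fin n]→L[ℝ] ℝ}
    (hα : DifferentiableAt ℝ α x) (hω : DifferentiableAt ℝ ω x) :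
    DifferentiableAt ℝ (fun y => wedge (α y) (ω y)) x :=
  ((wedgeL n).hasFDerivAt_of_bilinear hα.hasFDerivAt hω.hasFDerivAt).differentiableAt

theorem hasFDerivAt_toForm {α' : Coord4 →L[ℝ] Covector} (hα : HasFDerivAt α α' x) :
    HasFDerivAt (fun y => toForm (α y)) (toFormL.comp α') x :=
  toFormL.hasFDerivAt.comp x hα

theorem extDeriv_toForm_apply (hα : DifferentiableAt ℝ α x) (v : Fin 2 → Coord4) :
    extDeriv (fun y => toForm (α y)) x v
      = fderiv ℝ α x (v 0) (v 1) - fderiv ℝ α x (v 1) (v 0) := by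
  rw [extDeriv, (hasFDerivAt_toForm hα.hasFDerivAt).fderiv,
    ContinuousAlternatingMap.alternatizeUncurryFin_apply]
  simp [Fin.removeNth, toFormL, sub_eq_add_neg]

theorem extDeriv_wedge_toForm (hα : DifferentiableAt ℝ α x) (hβ : DifferentiableAt ℝ β x) :
    extDeriv (fun y => wedge (α y) (toForm (β y))) x
      = wedge (β x) (extDeriv (fun y => toForm (α y)) x)
        - wedge (α x) (extDeriv (fun y => toForm (β y)) x) := by
  have h := (wedgeL 1).hasFDerivAt_of_bilinear hα.hasFDerivAt (hasFDerivAt_toForm hβ.hasFDerivAt)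
  have h_apply (u v w : Coord4) :
      fderiv ℝ (fun y => wedge (α y) (toForm (β y))) x u ![v, w]
        = wedge (α x) (toForm (fderiv ℝ β x u)) ![v, w]
          + wedge (fderiv ℝ α x u) (toForm (β x)) ![v, w] :=
    congrArg (fun L => L u ![v, w]) h.fderiv
  ext v
  refine (alternatizeUncurryFin_two_apply _ v).trans ?_
  simp only [h_apply, ContinuousAlternatingMap.sub_apply, wedge_two_apply, wedge_toForm_apply,
    extDeriv_toForm_apply hα, extDeriv_toForm_apply hβ, Matrix.cons_val_zero, Matrix.cons_val_one]
  ring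

theorem extDeriv_fun_smul_form {f : Coord4 → ℝ} {ω : Coord4 → Coord4 [⋀^Fin n]→L[ℝ] ℝ}
    (hf : DifferentiableAt ℝ f x) (hω : DifferentiableAt ℝ ω x) :
    extDeriv (fun y => f y • ω y) x = wedge (fderiv ℝ f x) (ω x) + f x • extDeriv ω x := by
  rw [extDeriv, extDeriv, fderiv_fun_smul hf hω, ContinuousAlternatingMap.alternatizeUncurryFin_add,
    ContinuousAlternatingMap.alternatizeUncurryFin_smul]
  exact add_comm _ _

end Forms

/-! ### The self-dual forms of the Taub-NUT tetrad -/

theorem sqrt_potV_ne_zero {x : Coord4} (hx : x ∈ chart) : Real.sqrt (potV x) ≠ 0 := by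
  have hr : 0 < x 0 := hx.1
  rw [Real.sqrt_ne_zero', potV]
  positivity

theorem sq_sqrt_potV {x : Coord4} (hx : x ∈ chart) : Real.sqrt (potV x) ^ 2 = potV x :=
  Real.sq_sqrt (Real.sqrt_ne_zero'.1 (sqrt_potV_ne_zero hx)).le

theorem sum_tetrad_sq {x : Coord4} (hx : x ∈ chart) (v : Coord4) :
    ∑ a, (tetrad a x v) ^ 2 = metric x v := by
  simp only [Fin.sum_univ_four, tetrad, eta, metric, dx, Matrix.cons_val, Matrix.cons_val_zero,
    Matrix.cons_val_one, _root_.smul_apply, _root_.add_apply,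
    ContinuousLinearMap.proj_apply, smul_eq_mul, mul_pow, sq_sqrt_potV hx, div_pow, one_pow]
  linear_combination (potV x * x 0 ^ 2 * (v 1 ^ 2 + Real.sin (x 1) ^ 2 * v 2 ^ 2))
    * Real.sin_sq_add_cos_sq (x 3)

theorem isOpen_chart : IsOpen chart :=
  (isOpen_lt continuous_const (continuous_apply 0)).inter
    ((isOpen_lt continuous_const (continuous_apply 1)).inter
      (isOpen_lt (continuous_apply 1) continuous_const))

theorem differentiable_eta (j : Fin 3) : Differentiable ℝ (eta j) := by
  match j with
  | 0 | 1 | 2 =>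
    simp +unfoldPartialApp only [eta, Matrix.cons_val]
    fun_prop

/-- The forms `dηᵢ`, by the Maurer-Cartan equations. -/
noncomputable def areaForm (i : Fin 3) (x : Coord4) : Coord4 [⋀^Fin 2]→L[ℝ] ℝ :=
  wedge (eta (i + 1) x) (toForm (eta (i + 2) x))

theorem extDeriv_eta (i : Fin 3) (x : Coord4) :
    extDeriv (fun y => toForm (eta i y)) x = areaForm i x := by
  have hs (k : Fin 4) : HasFDerivAt (fun y : Coord4 => Real.sin (y k)) (Real.cos (x k) • dx k) x :=
    (hasFDerivAt_apply k x).sin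
  have hc (k : Fin 4) : HasFDerivAt (fun y : Coord4 => Real.cos (y k)) (-Real.sin (x k) • dx k) x :=
    (hasFDerivAt_apply k x).cos
  ext v
  rw [extDeriv_toForm_apply (differentiable_eta i x), areaForm, wedge_toForm_apply]
  match i with
  | 0 =>
    have h : fderiv ℝ (eta 0) x = _ := (((hs 3).fun_neg.smul_const (dx 1)).fun_add
      (((hs 1).fun_mul (hc 3)).smul_const (dx 2))).fderiv
    rw [h]
    simp [eta, dx]
    ring
  | 1 =>
    have h : fderiv ℝ (eta 1) x = _ := (((hc 3).smul_const (dx 1)).fun_add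
      (((hs 1).fun_mul (hs 3)).smul_const (dx 2))).fderiv
    rw [h]
    simp [eta, dx]
    ring
  | 2 =>
    have h : fderiv ℝ (eta 2) x = _ :=
      ((hasFDerivAt_const (dx 3) x).fun_add ((hc 1).smul_const (dx 2))).fderiv
    rw [h]
    simp [eta, dx]
    linear_combination Real.sin (x 1) * (v 0 1 * v 1 2 - v 1 1 * v 0 2) *
      Real.sin_sq_add_cos_sq (x 3)

theorem differentiable_areaForm (i : Fin 3) : Differentiable ℝ (areaForm i) := fun x =>
  differentiableAt_wedge (differentiable_eta (i + 1) x)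
    (hasFDerivAt_toForm (differentiable_eta (i + 2) x).hasFDerivAt).differentiableAt

theorem extDeriv_areaForm (i : Fin 3) (x : Coord4) : extDeriv (areaForm i) x = 0 := by
  have h₁ : i + 1 + 1 = i + 2 := by rw [add_assoc]; rfl
  have h₂ : i + 2 + 2 = i + 1 := by rw [add_assoc]; rfl
  refine (extDeriv_wedge_toForm (differentiable_eta (i + 1) x) (differentiable_eta (i + 2) x)).trans
    ?_
  rw [extDeriv_eta, extDeriv_eta, areaForm, areaForm, h₁, h₂, wedge_wedge_self_left,
    wedge_wedge_self_right, sub_zero]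

theorem extDeriv_dx_wedge_eta (k : Fin 4) (i : Fin 3) (x : Coord4) :
    extDeriv (fun y => wedge (dx k) (toForm (eta i y))) x = -wedge (dx k) (areaForm i x) := by
  have h : extDeriv (fun _ : Coord4 => toForm (dx k)) x = 0 := by
    ext v
    simp [extDeriv_toForm_apply (differentiableAt_const (dx k))]
  rw [extDeriv_wedge_toForm (differentiableAt_const (dx k)) (differentiable_eta i x), h,
    extDeriv_eta, wedge_zero, zero_sub]

/-- The factor by which `eᵢ` is a multiple of `ηᵢ`. -/
noncomputable def tetradScale (i : Fin 3) (x : Coord4) : ℝ :=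
  ![x 0 * Real.sqrt (potV x), x 0 * Real.sqrt (potV x), 1 / Real.sqrt (potV x)] i

theorem tetrad_zero (x : Coord4) : tetrad 0 x = Real.sqrt (potV x) • dx 0 := rfl

theorem tetrad_succ (i : Fin 3) (x : Coord4) : tetrad i.succ x = tetradScale i x • eta i x := by
  fin_cases i <;> rfl

/-- The coefficient of `dr ∧ ηᵢ` in `Σᵢ`. -/
noncomputable def radialCoeff (i : Fin 3) (r : ℝ) : ℝ := ![r + 1, r + 1, 1] i

/-- The coefficient of `ηᵢ₊₁ ∧ ηᵢ₊₂` in `Σᵢ`. -/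
noncomputable def angularCoeff (i : Fin 3) (r : ℝ) : ℝ := ![r, r, r * (r + 1)] i

theorem sqrt_potV_mul_tetradScale {x : Coord4} (hx : x ∈ chart) (i : Fin 3) :
    Real.sqrt (potV x) * tetradScale i x = radialCoeff i (x 0) := by
  have hr : x 0 ≠ 0 := hx.1.ne'
  have hV : x 0 * Real.sqrt (potV x) ^ 2 = x 0 + 1 := by rw [sq_sqrt_potV hx, potV]; field_simp
  have h := sqrt_potV_ne_zero hx
  fin_cases i <;> simp [tetradScale, radialCoeff, h] <;> linear_combination hV

theorem tetradScale_mul_tetradScale {x : Coord4} (hx : x ∈ chart) (i : Fin 3) :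
    tetradScale (i + 1) x * tetradScale (i + 2) x = angularCoeff i (x 0) := by
  have h_succ : x 0 * Real.sqrt (potV x) * Real.sqrt (potV x) = x 0 + 1 := by
    simpa [tetradScale, radialCoeff, mul_comm] using sqrt_potV_mul_tetradScale hx 0
  have h := sqrt_potV_ne_zero hx
  fin_cases i
  · simp [tetradScale, angularCoeff, h]
  · simp [tetradScale, angularCoeff, mul_comm, h]
  · simp [tetradScale, angularCoeff]
    linear_combination x 0 * h_succ

theorem selfDualForm_eq_tetrad (i : Fin 3) (x : Coord4) :
    selfDualForm i x = wedge (tetrad 0 x) (toForm (tetrad i.succ x))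
      + wedge (tetrad (i + 1).succ x) (toForm (tetrad (i + 2).succ x)) := by
  ext v
  fin_cases i <;> simp [selfDualForm, Fin.sum_univ_three, levi, wedge_toForm_apply] <;> ring

theorem selfDualForm_eq_eta {x : Coord4} (hx : x ∈ chart) (i : Fin 3) :
    selfDualForm i x = radialCoeff i (x 0) • wedge (dx 0) (toForm (eta i x))
      + angularCoeff i (x 0) • areaForm i x := by
  have h_smul (a b : ℝ) (α β : Covector) :
      wedge (a • α) (toForm (b • β)) = (a * b) • wedge α (toForm β) := by
    rw [smul_wedge, mul_smul]
    exact congrArg (a • ·) (wedge_smul α b (toForm β))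
  rw [selfDualForm_eq_tetrad, tetrad_zero, tetrad_succ, tetrad_succ, tetrad_succ, h_smul, h_smul,
    sqrt_potV_mul_tetradScale hx, tetradScale_mul_tetradScale hx, areaForm]

theorem hasFDerivAt_comp_radial {f : ℝ → ℝ} {f' : ℝ} {x : Coord4} (hf : HasDerivAt f f' (x 0)) :
    HasFDerivAt (fun y : Coord4 => f (y 0)) (f' • dx 0) x :=
  hf.comp_hasFDerivAt x (hasFDerivAt_apply 0 x)

theorem extDeriv_comp_radial_smul {n : ℕ} {f : ℝ → ℝ} {f' : ℝ}
    {ω : Coord4 → Coord4 [⋀^Fin n]→L[ℝ] ℝ} {x : Coord4} (hf : HasDerivAt f f' (x 0))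
    (hω : DifferentiableAt ℝ ω x) :
    extDeriv (fun y => f (y 0) • ω y) x = f' • wedge (dx 0) (ω x) + f (x 0) • extDeriv ω x := by
  have h := hasFDerivAt_comp_radial hf
  rw [extDeriv_fun_smul_form h.differentiableAt hω, h.fderiv, smul_wedge]

theorem hasDerivAt_radialCoeff (i : Fin 3) (r : ℝ) :
    HasDerivAt (radialCoeff i) (![1, 1, 0] i) r := by
  match i with
  | 0 | 1 => exact (hasDerivAt_id r).add_const 1
  | 2 => exact hasDerivAt_const r 1

theorem hasDerivAt_angularCoeff (i : Fin 3) (r : ℝ) :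
    HasDerivAt (angularCoeff i) (![1, 1, 2 * r + 1] i) r := by
  match i with
  | 0 | 1 => exact hasDerivAt_id r
  | 2 =>
    refine ((hasDerivAt_id r).mul ((hasDerivAt_id r).add_const 1)).congr_deriv ?_
    simp
    ring

theorem extDeriv_selfDualForm {x : Coord4} (hx : x ∈ chart) (i : Fin 3) :
    extDeriv (selfDualForm i) x
      = (![1, 1, 2 * x 0 + 1] i - radialCoeff i (x 0)) • wedge (dx 0) (areaForm i x) := by
  have h_near : selfDualForm i =ᶠ[nhds x] fun y =>
      radialCoeff i (y 0) • wedge (dx 0) (toForm (eta i y))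
        + angularCoeff i (y 0) • areaForm i y :=
    (isOpen_chart.eventually_mem hx).mono fun y hy => selfDualForm_eq_eta hy i
  have h_radial := (hasFDerivAt_comp_radial (hasDerivAt_radialCoeff i (x 0))).differentiableAt
  have h_angular := (hasFDerivAt_comp_radial (hasDerivAt_angularCoeff i (x 0))).differentiableAt
  have h_wedge : DifferentiableAt ℝ (fun y => wedge (dx 0) (toForm (eta i y))) x :=
    differentiableAt_wedge (differentiableAt_const _)
      (hasFDerivAt_toForm (differentiable_eta i x).hasFDerivAt).differentiableAt
  rw [h_near.extDeriv_eq, extDeriv_fun_add (h_radial.fun_smul h_wedge)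
      (h_angular.fun_smul (differentiable_areaForm i x)),
    extDeriv_comp_radial_smul (hasDerivAt_radialCoeff i (x 0)) h_wedge,
    extDeriv_comp_radial_smul (hasDerivAt_angularCoeff i (x 0)) (differentiable_areaForm i x),
    wedge_wedge_self_left, extDeriv_dx_wedge_eta, extDeriv_areaForm]
  module

/-! ### The self-dual spin connection -/

theorem sum_fin_three_cyclic {M : Type*} [AddCommMonoid M] (f : Fin 3 → M) (i : Fin 3) :
    ∑ j, f j = f i + f (i + 1) + f (i + 2) := by
  rw [← Equiv.sum_comp (Equiv.addLeft i), Fin.sum_univ_three]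
  simp

theorem wedge_eta_selfDualForm_prev {x : Coord4} (hx : x ∈ chart) (i : Fin 3) :
    wedge (eta (i + 1) x) (selfDualForm (i + 2) x)
      = -radialCoeff (i + 2) (x 0) • wedge (dx 0) (areaForm i x) := by
  have h : i + 2 + 2 = i + 1 := by rw [add_assoc]; rfl
  rw [selfDualForm_eq_eta hx, areaForm, areaForm, h, wedge_add, wedge_smul, wedge_smul,
    wedge_wedge_self_right, smul_zero, add_zero, wedge_wedge_comm, smul_neg]
  exact (neg_smul _ _).symm

theorem wedge_eta_selfDualForm_next {x : Coord4} (hx : x ∈ chart) (i : Fin 3) :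
    wedge (eta (i + 2) x) (selfDualForm (i + 1) x)
      = radialCoeff (i + 1) (x 0) • wedge (dx 0) (areaForm i x) := by
  have h : i + 1 + 1 = i + 2 := by rw [add_assoc]; rfl
  rw [selfDualForm_eq_eta hx, areaForm, areaForm, h, wedge_add, wedge_smul, wedge_smul,
    wedge_wedge_self_left, smul_zero, add_zero, wedge_wedge_comm, wedge_toForm_comm,
    wedge_neg, neg_neg]

/-- The self-dual spin connection `γᵢⱼ = ∑ₖ εᵢⱼₖ fₖ ηₖ`. -/
noncomputable def spinConnection (i j : Fin 3) (x : Coord4) : Covector :=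
  ∑ k, (levi i j k * profile k (x 0)) • eta k x

theorem spinConnection_antisymm (i j : Fin 3) (x : Coord4) :
    spinConnection i j x = -spinConnection j i x := by
  rw [spinConnection, spinConnection, ← Finset.sum_neg_distrib]
  refine Finset.sum_congr rfl fun k _ => ?_
  have h : levi i j k = -levi j i k := by unfold levi; ring
  rw [h]
  module

theorem spinConnection_self (i : Fin 3) (x : Coord4) : spinConnection i i x = 0 := by
  simp [spinConnection, levi]

theorem spinConnection_next (i : Fin 3) (x : Coord4) :
    spinConnection i (i + 1) x = profile (i + 2) (x 0) • eta (i + 2) x := by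
  match i with
  | 0 | 1 | 2 =>
    simp only [spinConnection, Fin.sum_univ_three, levi, Fin.reduceAdd]
    norm_num

theorem spinConnection_prev (i : Fin 3) (x : Coord4) :
    spinConnection i (i + 2) x = -profile (i + 1) (x 0) • eta (i + 1) x := by
  match i with
  | 0 | 1 | 2 =>
    simp only [spinConnection, Fin.sum_univ_three, levi, Fin.reduceAdd]
    norm_num

theorem radialCoeff_profile_identity {r : ℝ} (hr : r + 1 ≠ 0) (i : Fin 3) :
    ![1, 1, 2 * r + 1] i - radialCoeff i r + profile (i + 2) r * radialCoeff (i + 1) r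
      + profile (i + 1) r * radialCoeff (i + 2) r = 0 := by
  fin_cases i <;> simp [radialCoeff, profile] <;> field_simp <;> ring

theorem isSelfDualSpinConnection_spinConnection : IsSelfDualSpinConnection spinConnection where
  antisymm x _ i j := spinConnection_antisymm i j x
  cartan x hx i := by
    have hr : x 0 + 1 ≠ 0 := by linarith [hx.1]
    rw [sum_fin_three_cyclic _ i, spinConnection_self, spinConnection_next, spinConnection_prev,
      smul_wedge, smul_wedge, wedge_eta_selfDualForm_prev hx, wedge_eta_selfDualForm_next hx,
      extDeriv_selfDualForm hx, zero_wedge, smul_smul, smul_smul, zero_add, ← add_smul, ← add_smul,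
      ← add_assoc, neg_mul_neg, radialCoeff_profile_identity hr, zero_smul]

theorem exists_dual_basis {e : Fin 4 → Covector} (he : ∀ v, (∀ a, e a v = 0) → v = 0) :
    ∃ E : Module.Basis (Fin 4) ℝ Coord4, ∀ a b, e a (E b) = if a = b then 1 else 0 := by
  let F : Coord4 →ₗ[ℝ] Coord4 := LinearMap.pi fun a => (e a : Coord4 →ₗ[ℝ] ℝ)
  have hF : Function.Injective F := (injective_iff_map_eq_zero F).2 fun v hv => he v (congrFun hv)
  let E := Module.Basis.ofEquivFun (LinearEquiv.ofInjectiveEndo F hF)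
  refine ⟨E, fun a b => ?_⟩
  have h : F (E b) = Pi.single b 1 := by
    rw [Module.Basis.coe_ofEquivFun]
    exact (LinearEquiv.ofInjectiveEndo F hF).apply_symm_apply _
  simpa [F, Pi.single_apply] using congrFun h a

theorem eq_zero_of_wedge_eq_wedge {e : Fin 4 → Covector} (he : ∀ v, (∀ a, e a v = 0) → v = 0)
    {S : Fin 3 → Coord4 [⋀^Fin 2]→L[ℝ] ℝ}
    (hS : ∀ i, S i = wedge (e 0) (toForm (e i.succ))
      + wedge (e (i + 1).succ) (toForm (e (i + 2).succ)))
    {α : Fin 3 → Covector}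
    (hα : ∀ i, wedge (α (i + 2)) (S (i + 1)) = wedge (α (i + 1)) (S (i + 2))) (i : Fin 3) :
    α i = 0 := by
  obtain ⟨E, hE⟩ := exists_dual_basis he
  have h_eval (i : Fin 3) (v : Fin 3 → Coord4) := congrArg (· v) (hα i)
  simp only [wedge_two_apply, hS, ContinuousAlternatingMap.add_apply, wedge_toForm_apply,
    cons_val] at h_eval
  have h_symm (i : Fin 3) : α (i + 2) (E (i + 1).succ) = α (i + 1) (E (i + 2).succ) := by
    have h := h_eval i ![E i.succ, E (i + 1).succ, E (i + 2).succ]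
    fin_cases i <;> simpa [hE] using h
  have h_diag (i : Fin 3) : -α (i + 1) (E (i + 1).succ) = α (i + 2) (E (i + 2).succ) := by
    have h := h_eval i ![E 0, E (i + 1).succ, E (i + 2).succ]
    fin_cases i <;> simpa [hE] using h.symm
  have h_next (i : Fin 3) : -α (i + 2) (E i.succ) = α (i + 1) (E 0) := by
    have h := h_eval i ![E 0, E i.succ, E (i + 1).succ]
    fin_cases i <;> simpa [hE] using h
  have h_prev (i : Fin 3) : α (i + 2) (E 0) = α (i + 1) (E i.succ) := by
    have h := h_eval i ![E 0, E i.succ, E (i + 2).succ]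
    fin_cases i <;> simpa [hE] using h
  have h_time (i : Fin 3) : α i (E 0) = 0 := by
    have h₁ := h_next (i + 2)
    have h₂ := h_prev (i + 1)
    simp only [add_assoc, Fin.reduceAdd, add_zero] at h₁ h₂
    linarith [h_symm i]
  have h_space_self (i : Fin 3) : α i (E i.succ) = 0 := by
    have h₁ := h_diag (i + 1)
    have h₂ := h_diag (i + 2)
    simp only [add_assoc, Fin.reduceAdd, add_zero] at h₁ h₂
    linarith [h_diag i]
  have h_space_next (i : Fin 3) : α (i + 1) (E i.succ) = 0 := by rw [← h_prev, h_time]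
  have h_space_prev (i : Fin 3) : α (i + 2) (E i.succ) = 0 := by
    rw [neg_eq_iff_eq_neg.1 (h_next i), h_time, neg_zero]
  refine ContinuousLinearMap.coe_injective (E.ext fun a => ?_)
  obtain rfl | ⟨j, rfl⟩ := a.eq_zero_or_eq_succ
  · exact h_time i
  · obtain rfl | rfl | rfl : i = j ∨ i = j + 1 ∨ i = j + 2 := by grind
    exacts [h_space_self i, h_space_next j, h_space_prev j]

theorem eq_zero_of_tetrad_eq_zero {x : Coord4} (hx : x ∈ chart) {v : Coord4}
    (hv : ∀ a, tetrad a x v = 0) : v = 0 := by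
  have hr : 0 < x 0 := hx.1
  have hsin : Real.sin (x 1) ≠ 0 := (Real.sin_pos_of_pos_of_lt_pi hx.2.1 hx.2.2).ne'
  have hV : 0 < potV x := Real.sqrt_ne_zero'.1 (sqrt_potV_ne_zero hx)
  have h_metric : metric x v = 0 := by simp [← sum_tetrad_sq hx, hv]
  rw [metric, add_eq_zero_iff_of_nonneg (by positivity) (by positivity), mul_eq_zero,
    or_iff_right hV.ne'] at h_metric
  obtain ⟨h_base, h_fibre⟩ := h_metric
  obtain ⟨h₀, h_sphere⟩ := (add_eq_zero_iff_of_nonneg (by positivity) (by positivity)).1 h_base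
  rw [mul_eq_zero, or_iff_right (by positivity),
    add_eq_zero_iff_of_nonneg (by positivity) (by positivity), mul_eq_zero,
    or_iff_right (by positivity)] at h_sphere
  obtain ⟨h₁, h₂⟩ := h_sphere
  rw [sq_eq_zero_iff] at h₀ h₁ h₂
  rw [mul_eq_zero, or_iff_right (by positivity), sq_eq_zero_iff, h₂, mul_zero, add_zero] at h_fibre
  ext k
  fin_cases k <;> assumption

theorem IsSelfDualSpinConnection.unique {γ γ' : Fin 3 → Fin 3 → Coord4 → Covector}
    (h : IsSelfDualSpinConnection γ) (h' : IsSelfDualSpinConnection γ') {x : Coord4}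
    (hx : x ∈ chart) (i j : Fin 3) : γ i j x = γ' i j x := by
  let δ (i j : Fin 3) : Covector := γ i j x - γ' i j x
  have hδ_antisymm (i j : Fin 3) : δ i j = -δ j i := by
    simp only [δ, h.antisymm x hx i j, h'.antisymm x hx i j]
    abel
  have hδ_cartan (i : Fin 3) : ∑ j, wedge (δ i j) (selfDualForm j x) = 0 := by
    simp only [δ, sub_wedge, Finset.sum_sub_distrib]
    exact sub_eq_zero.2 (add_left_cancel ((h.cartan x hx i).trans (h'.cartan x hx i).symm))
  have hδ_self (i : Fin 3) : δ i i = 0 := by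
    ext v
    exact self_eq_neg.1 (congrArg (· v) (hδ_antisymm i i))
  have hδ_dual (k : Fin 3) : δ (k + 1) (k + 2) = 0 := by
    refine eq_zero_of_wedge_eq_wedge (fun v => eq_zero_of_tetrad_eq_zero hx)
      (fun i => selfDualForm_eq_tetrad i x) (α := fun k => δ (k + 1) (k + 2)) (fun i => ?_) k
    have h_sum := hδ_cartan i
    rw [sum_fin_three_cyclic _ i, hδ_self, zero_wedge, zero_add, hδ_antisymm i (i + 2), neg_wedge,
      ← sub_eq_add_neg, sub_eq_zero] at h_sum
    simpa only [add_assoc, Fin.reduceAdd, add_zero] using h_sum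
  refine sub_eq_zero.1 (?_ : δ i j = 0)
  obtain rfl | rfl | rfl : j = i ∨ j = i + 1 ∨ j = i + 2 := by grind
  · exact hδ_self j
  · simpa only [add_assoc, Fin.reduceAdd, add_zero] using hδ_dual (i + 2)
  · rw [hδ_antisymm, neg_eq_zero]
    simpa only [add_assoc, Fin.reduceAdd, add_zero] using hδ_dual (i + 1)

theorem potentialComponent_spinConnection (i : Fin 3) (x : Coord4) :
    potentialComponent spinConnection i x = profile i (x 0) • eta i x := by
  ext v
  fin_cases i <;>
    simp [potentialComponent, spinConnection, Fin.sum_univ_three, levi] <;> ring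

theorem IsSelfDualSpinConnection.potentialComponent_eq {γ : Fin 3 → Fin 3 → Coord4 → Covector}
    (h : IsSelfDualSpinConnection γ) {x : Coord4} (hx : x ∈ chart) (i : Fin 3) :
    potentialComponent γ i x = profile i (x 0) • eta i x := by
  rw [← potentialComponent_spinConnection]
  simp only [potentialComponent, h.unique isSelfDualSpinConnection_spinConnection hx]

theorem eta_partialVec (j : Fin 3) (x : Coord4) :
    eta j x (partialVec 2) = unitVec j (x 1) (x 3) := by
  fin_cases j <;> simp [eta, dx, partialVec, unitVec]

theorem IsSelfDualSpinConnection.potentialComponent_partialVec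
    {γ : Fin 3 → Fin 3 → Coord4 → Covector} (h : IsSelfDualSpinConnection γ) {x : Coord4}
    (hx : x ∈ chart) (i : Fin 3) :
    potentialComponent γ i x (partialVec 2) = profile i (x 0) * unitVec i (x 1) (x 3) := by
  rw [h.potentialComponent_eq hx, ← eta_partialVec, _root_.smul_apply, smul_eq_mul]

/-! ### Holonomy -/

open scoped Matrix.Norms.Operator in
theorem hasDerivWithinAt_matrix {m n : Type*} [Finite m] [Finite n] {M : ℝ → Matrix m n ℂ}
    {M' : Matrix m n ℂ} {s : Set ℝ} {t : ℝ} :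
    HasDerivWithinAt M M' s t ↔ ∀ a b, HasDerivWithinAt (fun t => M t a b) (M' a b) s t := by
  let _ := Fintype.ofFinite m
  let _ := Fintype.ofFinite n
  exact hasDerivWithinAt_pi.trans (forall_congr' fun _ => hasDerivWithinAt_pi)

theorem eqOn_exp_smul_of_hasDerivWithinAt {A : Type*} [NormedRing A] [NormedAlgebra ℝ A]
    [CompleteSpace A] {M : A} {b : ℝ} {Ψ : ℝ → A} (h_init : Ψ 0 = 1)
    (h_ode : ∀ s ∈ Icc 0 b, HasDerivWithinAt Ψ (M * Ψ s) (Icc 0 b) s) :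
    EqOn Ψ (fun s => NormedSpace.exp (s • M)) (Icc 0 b) := by
  refine ODE_solution_unique (v := fun _ X => M * X)
    (fun _ => (ContinuousLinearMap.mul ℝ A M).lipschitz)
    (fun s hs => (h_ode s hs).continuousWithinAt)
    (fun s hs => (h_ode s (Ico_subset_Icc_self hs)).mono_of_mem_nhdsWithin
      (Icc_mem_nhdsGE_of_mem hs))
    (fun s _ => (hasDerivAt_exp_smul_const' M s).continuousAt.continuousWithinAt)
    (fun s _ => (hasDerivAt_exp_smul_const' M s).hasDerivWithinAt) ?_
  simp [h_init]

open scoped Matrix.Norms.Operator in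
theorem isHolonomy_of_const {A : Coord4 → Coord4 → Matrix (Fin 2) (Fin 2) ℂ} {q : Coord3}
    {M : Matrix (Fin 2) (Fin 2) ℂ} (hM : ∀ s, A (orbitPoint q s) (partialVec 2) = M) :
    IsHolonomy A q (NormedSpace.exp ((2 * π) • -M)) := by
  refine ⟨⟨fun s => NormedSpace.exp (s • -M), ?_, fun s _ => ?_⟩, fun Ψ hΨ => ?_⟩
  · simp
  · rw [hM]
    exact hasDerivWithinAt_matrix.1 (hasDerivAt_exp_smul_const' (-M) s).hasDerivWithinAt
  · refine eqOn_exp_smul_of_hasDerivWithinAt hΨ.init (fun s hs => ?_)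
      (right_mem_Icc.2 Real.two_pi_pos.le)
    have h := hasDerivWithinAt_matrix.2 (hΨ.ode s hs)
    rwa [hM] at h

theorem IsSelfDualSpinConnection.isHolonomy {γ : Fin 3 → Fin 3 → Coord4 → Covector}
    (h : IsSelfDualSpinConnection γ) {q : Coord3} (hq : q ∈ orbitSpace) :
    IsHolonomy (potential γ) q (skyrmeField q) := by
  have h_const (s : ℝ) : potential γ (orbitPoint q s) (partialVec 2)
      = ∑ j, ((profile j (q 0) * unitVec j (q 1) (q 2) : ℝ) : ℂ) • gen j := by
    have hs : orbitPoint q s ∈ chart := ⟨hq.1, hq.2.1⟩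
    simp only [potential, h.potentialComponent_partialVec hs]
    rfl
  convert isHolonomy_of_const h_const using 1
  rw [skyrmeField, ← Finset.sum_neg_distrib, Finset.smul_sum, Finset.smul_sum]
  congr 1
  refine Finset.sum_congr rfl fun j _ => ?_
  rw [gen, ← Complex.coe_smul]
  module

/-! ### Quaternions and the trace of the cube -/

/-- The isomorphism of the quaternions with the real span of `1, -iτ₁, -iτ₂, -iτ₃`. -/
noncomputable def pauliHom : ℍ[ℝ] →ₐ[ℝ] Matrix (Fin 2) (Fin 2) ℂ :=
  QuaternionAlgebra.Basis.liftHom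
    { i := -Complex.I • pauli 0
      j := -Complex.I • pauli 1
      k := -Complex.I • pauli 2
      i_mul_i := by simp [smul_smul, pauli_mul_self]
      j_mul_j := by simp [smul_smul, pauli_mul_self]
      i_mul_j := by
        simpa [smul_smul] using pauli_mul_pauli_add_one 0
      j_mul_i := by
        simpa [smul_smul, neg_eq_iff_eq_neg] using pauli_add_one_mul_pauli 0 }

theorem pauliHom_apply (x : ℍ[ℝ]) :
    pauliHom x = x.re • 1 + x.imI • (-Complex.I • pauli 0) + x.imJ • (-Complex.I • pauli 1)
      + x.imK • (-Complex.I • pauli 2) := by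
  rw [← Algebra.algebraMap_eq_smul_one]
  rfl

theorem continuous_pauliHom : Continuous pauliHom :=
  pauliHom.toLinearMap.continuous_of_finiteDimensional

theorem pauliHom_eq_of (x : ℍ[ℝ]) :
    pauliHom x = !![x.re - x.imK * Complex.I, -x.imJ - x.imI * Complex.I;
      x.imJ - x.imI * Complex.I, x.re + x.imK * Complex.I] := by
  ext i j
  fin_cases i <;> fin_cases j <;> simp [pauliHom_apply, pauli] <;> ring

theorem trace_pauliHom (x : ℍ[ℝ]) : (pauliHom x).trace = ((2 * x.re : ℝ) : ℂ) := by
  rw [pauliHom_eq_of, trace_fin_two_of]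
  push_cast
  ring

theorem det_pauliHom (x : ℍ[ℝ]) : (pauliHom x).det = ((Quaternion.normSq x : ℝ) : ℂ) := by
  rw [pauliHom_eq_of, det_fin_two_of, Quaternion.normSq_def']
  push_cast
  linear_combination (-(x.imI : ℂ) ^ 2 - (x.imK : ℂ) ^ 2) * Complex.I_sq

theorem pauliHom_star (x : ℍ[ℝ]) : pauliHom (star x) = star (pauliHom x) := by
  ext i j
  rw [pauliHom_eq_of, pauliHom_eq_of]
  fin_cases i <;> fin_cases j <;> simp [star_apply]

theorem pauliHom_mem_specialUnitaryGroup {x : ℍ[ℝ]} (hx : Quaternion.normSq x = 1) :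
    pauliHom x ∈ specialUnitaryGroup (Fin 2) ℂ := by
  rw [mem_specialUnitaryGroup_iff, mem_unitaryGroup_iff, ← pauliHom_star, ← map_mul,
    Quaternion.self_mul_star, det_pauliHom, hx]
  simp

theorem inv_pauliHom {x : ℍ[ℝ]} (hx : Quaternion.normSq x = 1) :
    (pauliHom x)⁻¹ = pauliHom (star x) := by
  refine inv_eq_left_inv ?_
  rw [← map_mul, Quaternion.star_mul_self, hx]
  simp

theorem normSq_exp_of_re_eq_zero {x : ℍ[ℝ]} (hx : x.re = 0) :
    Quaternion.normSq (NormedSpace.exp x) = 1 := by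
  rw [Quaternion.normSq_exp, hx]
  simp

theorem sum_perm_fin_three {M : Type*} [AddCommMonoid M] (f : Equiv.Perm (Fin 3) → M) :
    ∑ σ, f σ = f 1 + (f (Equiv.swap 0 1) + (f (Equiv.swap 0 2) + (f (Equiv.swap 1 2)
      + (f (finRotate 3) + f (finRotate 3)⁻¹)))) := by
  have univ_eq : (Finset.univ : Finset (Equiv.Perm (Fin 3))) = {1, Equiv.swap 0 1, Equiv.swap 0 2,
      Equiv.swap 1 2, finRotate 3, (finRotate 3)⁻¹} := by decide
  rw [univ_eq]
  repeat rw [Finset.sum_insert (by decide)]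
  rw [Finset.sum_singleton]

theorem sum_sign_re_mul_mul (x : Fin 3 → ℍ[ℝ]) :
    ∑ σ : Equiv.Perm (Fin 3), ((Equiv.Perm.sign σ : ℤ) : ℝ) * (x (σ 0) * x (σ 1) * x (σ 2)).re
      = -6 * det (of fun k => ![(x k).imI, (x k).imJ, (x k).imK]) := by
  have swap_apply : Equiv.swap (0 : Fin 3) 1 2 = 2 ∧ Equiv.swap (0 : Fin 3) 2 1 = 1 ∧
      Equiv.swap (1 : Fin 3) 2 0 = 0 := by decide
  have finRotate_apply : ∀ i : Fin 3, finRotate 3 i = i + 1 ∧ (finRotate 3)⁻¹ i = i + 2 := by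
    decide
  simp only [sum_perm_fin_three, Equiv.Perm.sign_one, Equiv.Perm.sign_inv, sign_finRotate,
    Equiv.Perm.sign_swap', swap_apply, finRotate_apply, Equiv.swap_apply_left,
    Equiv.swap_apply_right, det_fin_three, Quaternion.re_mul, Quaternion.imI_mul,
    Quaternion.imJ_mul, Quaternion.imK_mul]
  simp
  ring

theorem det_im_star_mul (x : ℍ[ℝ]) (y : Fin 3 → ℍ[ℝ]) :
    det (of fun k => ![(star x * y k).imI, (star x * y k).imJ, (star x * y k).imK])
      = Quaternion.normSq x * det (of fun i => Quaternion.equivTuple ℝ (vecCons x y i)) := by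
  simp [det_succ_row_zero, Fin.sum_univ_succ, Quaternion.normSq_def', Fin.succAbove]
  ring

theorem leftCurrent_pauliHom {u : Coord3 → ℍ[ℝ]} {u' : ℍ[ℝ]} {q : Coord3} {k : Fin 3}
    (hq : Quaternion.normSq (u q) = 1) (hu : HasLineDerivAt ℝ u u' q (partialVec k)) :
    leftCurrent (fun p => pauliHom (u p)) k q = pauliHom (star (u q) * u') := by
  rw [leftCurrent, inv_pauliHom hq, map_mul]
  congr 1
  ext a b
  let entry : ℍ[ℝ] →L[ℝ] ℂ := LinearMap.toContinuousLinearMap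
    (LinearMap.comp (entryLinearMap ℝ ℂ a b) pauliHom.toLinearMap)
  exact (entry.hasFDerivAt.comp_hasDerivAt 0 hu).deriv

theorem traceCube_pauliHom {u : Coord3 → ℍ[ℝ]} {u' : Fin 3 → ℍ[ℝ]} {q : Coord3}
    (hq : Quaternion.normSq (u q) = 1)
    (hu : ∀ k, HasLineDerivAt ℝ u (u' k) q (partialVec k)) :
    traceCube (fun p => pauliHom (u p)) q
      = ((-12 * det (of fun i => Quaternion.equivTuple ℝ (vecCons (u q) u' i)) : ℝ) : ℂ) := by
  have det_currents := det_im_star_mul (u q) u'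
  rw [hq, one_mul] at det_currents
  have sum_perm := sum_sign_re_mul_mul fun k => star (u q) * u' k
  rw [det_currents] at sum_perm
  simp only [traceCube, leftCurrent_pauliHom hq (hu _), ← map_mul, trace_pauliHom]
  rw [show (-12 : ℝ) = 2 * -6 by norm_num, mul_assoc, ← sum_perm, Finset.mul_sum]
  push_cast
  exact Finset.sum_congr rfl fun σ _ => by ring

/-- The vector `v` of `ℝ³` as an imaginary quaternion. -/
noncomputable def imQuat : (Fin 3 → ℝ) →ₗ[ℝ] ℍ[ℝ] where
  toFun v := ⟨0, v 0, v 1, v 2⟩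
  map_add' _ _ := Quaternion.ext _ _ (add_zero 0).symm rfl rfl rfl
  map_smul' c _ := Quaternion.ext _ _ (mul_zero c).symm rfl rfl rfl

@[simp]
theorem re_imQuat (v : Fin 3 → ℝ) : (imQuat v).re = 0 := rfl

@[simp]
theorem imI_imQuat (v : Fin 3 → ℝ) : (imQuat v).imI = v 0 := rfl

@[simp]
theorem imJ_imQuat (v : Fin 3 → ℝ) : (imQuat v).imJ = v 1 := rfl

@[simp]
theorem imK_imQuat (v : Fin 3 → ℝ) : (imQuat v).imK = v 2 := rfl

theorem pauliHom_imQuat (v : Fin 3 → ℝ) :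
    pauliHom (imQuat v) = -Complex.I • ∑ j, (v j : ℂ) • pauli j := by
  rw [pauliHom_apply, Fin.sum_univ_three]
  simp only [re_imQuat, imI_imQuat, imJ_imQuat, imK_imQuat, ← Complex.coe_smul]
  push_cast
  module

theorem inner_imQuat (v w : Fin 3 → ℝ) : inner ℝ (imQuat v) (imQuat w) = v ⬝ᵥ w := by
  rw [Quaternion.inner_def]
  simp [dotProduct, Fin.sum_univ_three]

theorem sq_norm_imQuat (v : Fin 3 → ℝ) : ‖imQuat v‖ ^ 2 = v ⬝ᵥ v := by
  rw [← inner_imQuat, real_inner_self_eq_norm_sq]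

theorem exp_imQuat (v : Fin 3 → ℝ) :
    NormedSpace.exp (imQuat v) = Real.cos ‖imQuat v‖ • (1 : ℍ[ℝ])
      + (Real.sin ‖imQuat v‖ / ‖imQuat v‖) • imQuat v := by
  rw [Quaternion.exp_of_re_eq_zero _ (re_imQuat v), ← Algebra.algebraMap_eq_smul_one]
  rfl

theorem hasDerivAt_exp_imQuat {f : ℝ → Fin 3 → ℝ} {f' : Fin 3 → ℝ} {t ρ : ℝ}
    (hf : HasDerivAt f f' t) (hρ : ‖imQuat (f t)‖ = ρ) (hρ_ne : ρ ≠ 0) :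
    HasDerivAt (fun t => NormedSpace.exp (imQuat (f t)))
      ((-(Real.sin ρ / ρ) * (f t ⬝ᵥ f')) • (1 : ℍ[ℝ]) + ((Real.sin ρ / ρ) • imQuat f'
        + ((Real.cos ρ - Real.sin ρ / ρ) / ρ ^ 2 * (f t ⬝ᵥ f')) • imQuat (f t))) t := by
  have hF : HasDerivAt (fun t => imQuat (f t)) (imQuat f') t :=
    imQuat.toContinuousLinearMap.hasFDerivAt.comp_hasDerivAt t hf
  have hnorm : HasDerivAt (fun t => ‖imQuat (f t)‖) ((f t ⬝ᵥ f') / ρ) t := by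
    have := hF.norm_sq.sqrt (by simpa [hρ] using hρ_ne)
    simp only [norm_nonneg, Real.sqrt_sq, inner_imQuat] at this
    exact this.congr_deriv (by rw [hρ, mul_div_mul_left _ _ two_ne_zero])
  have hsinc := hnorm.sin.fun_div hnorm (by rwa [hρ])
  rw [hρ] at hsinc
  simp only [exp_imQuat]
  refine ((hnorm.cos.smul_const (1 : ℍ[ℝ])).fun_add (hsinc.fun_smul hF)).congr_deriv ?_
  rw [hρ]
  congr 2
  · ring
  · congr 1
    field_simp

/-- In the application `c`, `a` and `b` are `cos ρ`, `sin ρ / ρ` and the derivative of `sin ρ / ρ`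
divided by `ρ`. -/
theorem det_imQuat_frame (c a b : ℝ) (f : Fin 3 → ℝ) (f' : Fin 3 → Fin 3 → ℝ) :
    det (of fun i => Quaternion.equivTuple ℝ (vecCons (c • 1 + a • imQuat f)
      (fun k => (-a * (f ⬝ᵥ f' k)) • 1 + (a • imQuat (f' k) + (b * (f ⬝ᵥ f' k)) • imQuat f)) i))
      = a ^ 2 * (c * a + (c * b + a ^ 2) * (f ⬝ᵥ f)) * det (of f') := by
  simp [det_succ_row_zero, Fin.sum_univ_succ, dotProduct, Fin.succAbove]
  ring

theorem traceCube_pauliHom_exp_imQuat {f : Coord3 → Fin 3 → ℝ} {f' : Fin 3 → Fin 3 → ℝ}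
    {q : Coord3} (hf : ∀ k, HasLineDerivAt ℝ f (f' k) q (partialVec k)) {ρ : ℝ}
    (hρ : ‖imQuat (f q)‖ = ρ) (hρ_ne : ρ ≠ 0) :
    traceCube (fun p => pauliHom (NormedSpace.exp (imQuat (f p)))) q
      = ((-12 * (Real.sin ρ / ρ) ^ 2 * det (of f') : ℝ) : ℂ) := by
  have hu := fun k => hasDerivAt_exp_imQuat (hf k) (by simpa using hρ) hρ_ne
  simp only [zero_smul, add_zero] at hu
  rw [traceCube_pauliHom (u := fun p => NormedSpace.exp (imQuat (f p)))
    (normSq_exp_of_re_eq_zero (re_imQuat _)) hu, exp_imQuat, hρ,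
    det_imQuat_frame, ← sq_norm_imQuat, hρ]
  congr 1
  have := Real.sin_sq_add_cos_sq ρ
  field_simp
  linear_combination -ρ * det (of f') * Real.sin ρ ^ 2 * this

/-! ### The Skyrme field -/

/-- The vector `π (f₁ n₁, f₂ n₂, f₃ n₃)` of which the Skyrme field is the exponential. -/
noncomputable def skyrmeVector (q : Coord3) : Fin 3 → ℝ :=
  fun j => π * (profile j (q 0) * unitVec j (q 1) (q 2))

open scoped Matrix.Norms.Operator in
theorem skyrmeField_eq_pauliHom (q : Coord3) :
    skyrmeField q = pauliHom (NormedSpace.exp (imQuat (skyrmeVector q))) := by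
  let _ : NormedAlgebra ℚ ℍ[ℝ] := .restrictScalars ℚ ℝ ℍ[ℝ]
  let _ : NormedAlgebra ℝ (Matrix (Fin 2) (Fin 2) ℂ) := .restrictScalars ℝ ℂ _
  let _ : NormedAlgebra ℚ (Matrix (Fin 2) (Fin 2) ℂ) := .restrictScalars ℚ ℝ _
  rw [NormedSpace.map_exp pauliHom continuous_pauliHom, skyrmeField, pauliHom_imQuat]
  congr 1
  simp only [skyrmeVector, Fin.sum_univ_three]
  push_cast
  module

theorem skyrmeField_mem_specialUnitaryGroup (q : Coord3) :
    skyrmeField q ∈ specialUnitaryGroup (Fin 2) ℂ := by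
  rw [skyrmeField_eq_pauliHom]
  exact pauliHom_mem_specialUnitaryGroup (normSq_exp_of_re_eq_zero (re_imQuat _))

theorem hasDerivAt_profile (j : Fin 3) {r : ℝ} (hr : r + 1 ≠ 0) :
    HasDerivAt (profile j) (![-1, -1, 2 / (r + 1)] j / (r + 1) ^ 2) r := by
  have hden := (hasDerivAt_id r).add_const 1
  match j with
  | 0 | 1 => exact ((hasDerivAt_id r).neg.div hden hr).congr_deriv (by simp)
  | 2 =>
    refine (((hasDerivAt_id r).mul ((hasDerivAt_id r).add_const 2)).div (hden.pow 2)
      (pow_ne_zero 2 hr)).congr_deriv ?_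
    simp
    field_simp
    ring

theorem hasDerivAt_unitVec (j : Fin 3) {θ ψ : ℝ → ℝ} {θ' ψ' t : ℝ} (hθ : HasDerivAt θ θ' t)
    (hψ : HasDerivAt ψ ψ' t) :
    HasDerivAt (fun t => unitVec j (θ t) (ψ t))
      (θ' * ![Real.cos (θ t) * Real.cos (ψ t), Real.cos (θ t) * Real.sin (ψ t), -Real.sin (θ t)] j
        + ψ' * ![-Real.sin (θ t) * Real.sin (ψ t), Real.sin (θ t) * Real.cos (ψ t), 0] j) t := by
  match j with
  | 0 => exact (hθ.sin.mul hψ.cos).congr_deriv (by simp; ring)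
  | 1 => exact (hθ.sin.mul hψ.sin).congr_deriv (by simp; ring)
  | 2 => exact hθ.cos.congr_deriv (by simp; ring)

theorem hasLineDerivAt_skyrmeVector {q : Coord3} (hq : q 0 + 1 ≠ 0) (v : Coord3) :
    HasLineDerivAt ℝ skyrmeVector (fun j =>
      π * (![-1, -1, 2 / (q 0 + 1)] j / (q 0 + 1) ^ 2 * v 0 * unitVec j (q 1) (q 2)
        + profile j (q 0)
          * (v 1 * ![Real.cos (q 1) * Real.cos (q 2), Real.cos (q 1) * Real.sin (q 2),
              -Real.sin (q 1)] j
            + v 2 * ![-Real.sin (q 1) * Real.sin (q 2), Real.sin (q 1) * Real.cos (q 2), 0] j)))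
      q v := by
  have hline (i : Fin 3) : HasDerivAt (fun t : ℝ => (q + t • v) i) (v i) 0 :=
    (((hasDerivAt_id (0 : ℝ)).mul_const (v i)).const_add (q i)).congr_deriv (one_mul _)
  refine hasDerivAt_pi.2 fun j => ?_
  have hprofile := (hasDerivAt_profile j hq).comp_of_eq 0 (hline 0) (by simp)
  simpa [skyrmeVector] using (hprofile.mul (hasDerivAt_unitVec j (hline 1) (hline 2))).const_mul π

/-- `|F| / s`, where `F` is the vector `(f₁ n₁, f₂ n₂, f₃ n₃)`, in the compact radial coordinate
`s = r / (r + 1)`. -/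
noncomputable def normRatio (s θ : ℝ) : ℝ :=
  Real.sqrt (Real.sin θ ^ 2 + (2 - s) ^ 2 * Real.cos θ ^ 2)

theorem normRatio_pos {s : ℝ} (hs : s < 2) (θ : ℝ) : 0 < normRatio s θ := by
  refine Real.sqrt_pos.2 ?_
  rcases eq_or_ne (Real.cos θ) 0 with hcos | hcos
  · simp [Real.sin_sq, hcos]
  · have := sub_pos.2 hs
    positivity

theorem sq_normRatio (s θ : ℝ) :
    normRatio s θ ^ 2 = Real.sin θ ^ 2 + (2 - s) ^ 2 * Real.cos θ ^ 2 :=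
  Real.sq_sqrt (by positivity)

/-- The density of the degree of the Skyrme field in the coordinates `s = r / (r + 1)` and `θ`. -/
noncomputable def degreeDensity (s θ : ℝ) : ℝ :=
  Real.sin (π * (s * normRatio s θ)) ^ 2 / normRatio s θ ^ 2 * Real.sin θ
    * ((2 - s) - s * Real.cos θ ^ 2)

theorem norm_imQuat_skyrmeVector {q : Coord3} (hq : 0 ≤ q 0) :
    ‖imQuat (skyrmeVector q)‖
      = π * (q 0 / (q 0 + 1) * normRatio (q 0 / (q 0 + 1)) (q 1)) := by
  rw [← sq_eq_sq₀ (norm_nonneg _) (by unfold normRatio; positivity), sq_norm_imQuat, mul_pow,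
    mul_pow, sq_normRatio]
  have := Real.sin_sq_add_cos_sq (q 2)
  simp [skyrmeVector, profile, unitVec, dotProduct, Fin.sum_univ_three]
  field_simp
  linear_combination q 0 ^ 2 * Real.sin (q 1) ^ 2 * (q 0 + 1) ^ 2 * this

theorem traceCube_skyrmeField {q : Coord3} (hq : 0 < q 0) :
    traceCube skyrmeField q
      = ((-12 * π * (1 / (q 0 + 1) ^ 2 * degreeDensity (q 0 / (q 0 + 1)) (q 1)) : ℝ) : ℂ) := by
  have hr : q 0 + 1 ≠ 0 := by positivity
  have hs : q 0 / (q 0 + 1) < 2 := by rw [div_lt_iff₀ (by positivity)]; linarith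
  have hκ := normRatio_pos hs (q 1)
  rw [funext skyrmeField_eq_pauliHom, traceCube_pauliHom_exp_imQuat
    (fun k => hasLineDerivAt_skyrmeVector hr (partialVec k)) (norm_imQuat_skyrmeVector hq.le)
    (by positivity)]
  congr 1
  have hψ := Real.sin_sq_add_cos_sq (q 2)
  have hθ := Real.sin_sq_add_cos_sq (q 1)
  simp [det_fin_three, partialVec, profile, unitVec, degreeDensity]
  field_simp
  congr 1
  linear_combination (Real.sin (q 1) ^ 2 * (q 0 + 2) + 2 * Real.cos (q 1) ^ 2) * hψ
    + (q 0 + 2) * hθ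

theorem isOpen_orbitSpace : IsOpen orbitSpace := by
  have : orbitSpace = (fun q : Coord3 => q 0) ⁻¹' Ioi 0 ∩ ((fun q : Coord3 => q 1) ⁻¹' Ioo 0 π ∩
      (fun q : Coord3 => q 2) ⁻¹' Ioo 0 (4 * π)) := rfl
  rw [this]
  exact (isOpen_Ioi.preimage (continuous_apply 0)).inter
    ((isOpen_Ioo.preimage (continuous_apply 1)).inter (isOpen_Ioo.preimage (continuous_apply 2)))

theorem contDiffOn_profile (j : Fin 3) : ContDiffOn ℝ (⊤ : ℕ∞) (profile j) {-1}ᶜ := by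
  have hne : ∀ r ∈ ({-1}ᶜ : Set ℝ), r + 1 ≠ 0 := fun r hr h => hr (eq_neg_of_add_eq_zero_left h)
  match j with
  | 0 | 1 => exact contDiffOn_id.neg.div (by fun_prop) hne
  | 2 => exact ContDiffOn.div (by fun_prop) (by fun_prop) fun r hr => pow_ne_zero 2 (hne r hr)

theorem contDiff_unitVec (j : Fin 3) :
    ContDiff ℝ (⊤ : ℕ∞) fun p : ℝ × ℝ => unitVec j p.1 p.2 := by
  match j with
  | 0 | 1 | 2 => simp only [unitVec, cons_val]; fun_prop

open scoped Matrix.Norms.Operator in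
theorem contDiffOn_skyrmeField (a b : Fin 2) :
    ContDiffOn ℝ (⊤ : ℕ∞) (fun q => skyrmeField q a b) orbitSpace := by
  let _ : NormedAlgebra ℝ (Matrix (Fin 2) (Fin 2) ℂ) := .restrictScalars ℝ ℂ _
  let _ : NormedAlgebra ℚ (Matrix (Fin 2) (Fin 2) ℂ) := .restrictScalars ℚ ℝ _
  have contDiff_exp : ContDiff ℝ (⊤ : ℕ∞) (NormedSpace.exp : Matrix (Fin 2) (Fin 2) ℂ → _) :=
    contDiff_iff_contDiffAt.2 fun x => (NormedSpace.exp_analytic (𝕂 := ℝ) x).contDiffAt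
  let entry := (entryLinearMap ℝ ℂ a b).toContinuousLinearMap
  refine entry.contDiff.comp_contDiffOn (contDiff_exp.comp_contDiffOn ?_)
  refine ContDiffOn.const_smul _ (ContDiffOn.sum fun j _ => ?_)
  refine ContDiffOn.smul (Complex.ofRealCLM.contDiff.comp_contDiffOn ?_) contDiffOn_const
  refine ((contDiffOn_profile j).comp (by fun_prop) fun q hq => ?_).mul
    ((contDiff_unitVec j).comp_contDiffOn (f := fun q : Coord3 => (q 1, q 2)) (by fun_prop))
  exact (show -1 < q 0 by linarith [hq.1]).ne'

/-! ### The degree -/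

theorem hasDerivAt_normRatio_left {s : ℝ} (hs : s < 2) (θ : ℝ) :
    HasDerivAt (fun s => normRatio s θ) (-((2 - s) * Real.cos θ ^ 2) / normRatio s θ) s := by
  have harg := ((((hasDerivAt_id s).const_sub 2).fun_pow 2).mul_const
    (Real.cos θ ^ 2)).const_add (Real.sin θ ^ 2)
  refine (harg.sqrt (Real.sqrt_pos.1 (normRatio_pos hs θ)).ne').congr_deriv ?_
  simp only [id, normRatio]
  field_simp
  norm_num

theorem hasDerivAt_normRatio_right {s : ℝ} (hs : s < 2) (θ : ℝ) :
    HasDerivAt (normRatio s)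
      ((1 - (2 - s) ^ 2) * (Real.sin θ * Real.cos θ) / normRatio s θ) θ := by
  have harg := ((Real.hasDerivAt_sin θ).fun_pow 2).fun_add
    (((Real.hasDerivAt_cos θ).fun_pow 2).const_mul ((2 - s) ^ 2))
  refine (harg.sqrt (Real.sqrt_pos.1 (normRatio_pos hs θ)).ne').congr_deriv ?_
  simp only [normRatio]
  field_simp
  push_cast
  ring

/-- The antiderivative of `sin² (π ρ)` vanishing at `0`. -/
noncomputable def sinSqPrimitive (ρ : ℝ) : ℝ :=
  ρ / 2 - Real.sin (2 * π * ρ) / (4 * π)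

theorem hasDerivAt_sinSqPrimitive (ρ : ℝ) :
    HasDerivAt sinSqPrimitive (Real.sin (π * ρ) ^ 2) ρ := by
  refine (((hasDerivAt_id ρ).div_const 2).fun_sub
    ((((hasDerivAt_id ρ).const_mul (2 * π)).sin).div_const (4 * π))).congr_deriv ?_
  rw [Real.sin_sq_eq_half_sub, ← mul_assoc]
  simp only [id]
  field_simp
  ring

/-- The `s`-component of a vector field in the `(s, θ)`-plane with divergence `degreeDensity`. With
`F` as in `normRatio`, the degree form is the exterior derivative of the area form pulled back by
`F / |F|` times the primitive of `sin² (π |F|)`; the two fluxes are the coefficients of this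
two-form. -/
noncomputable def radialFlux (s θ : ℝ) : ℝ :=
  sinSqPrimitive (s * normRatio s θ) * ((2 - s) * Real.sin θ) / normRatio s θ ^ 3

/-- The `θ`-component of the vector field of which `radialFlux` is the `s`-component. -/
noncomputable def polarFlux (s θ : ℝ) : ℝ :=
  -(sinSqPrimitive (s * normRatio s θ) * (Real.cos θ * Real.sin θ ^ 2) / normRatio s θ ^ 3)

theorem hasDerivAt_radialFlux {s : ℝ} (hs : s < 2) (θ : ℝ) :
    HasDerivAt (fun s => radialFlux s θ)
      (Real.sin (π * (s * normRatio s θ)) ^ 2 * (2 - s) * Real.sin θ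
          * (normRatio s θ ^ 2 - s * (2 - s) * Real.cos θ ^ 2) / normRatio s θ ^ 4
        - sinSqPrimitive (s * normRatio s θ) * Real.sin θ
          * (normRatio s θ ^ 2 - 3 * (2 - s) ^ 2 * Real.cos θ ^ 2) / normRatio s θ ^ 5) s := by
  have hκ := (normRatio_pos hs θ).ne'
  have hnorm := hasDerivAt_normRatio_left hs θ
  have hprim := (hasDerivAt_sinSqPrimitive _).comp s ((hasDerivAt_id s).fun_mul hnorm)
  refine ((hprim.fun_mul (((hasDerivAt_id s).const_sub 2).mul_const (Real.sin θ))).fun_div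
    (hnorm.fun_pow 3) (pow_ne_zero 3 hκ)).congr_deriv ?_
  simp only [id, Function.comp]
  field_simp
  push_cast
  ring

theorem hasDerivAt_polarFlux {s : ℝ} (hs : s < 2) (θ : ℝ) :
    HasDerivAt (polarFlux s)
      (-(Real.sin (π * (s * normRatio s θ)) ^ 2 * s * (1 - (2 - s) ^ 2) * Real.sin θ ^ 3
          * Real.cos θ ^ 2 / normRatio s θ ^ 4)
        - sinSqPrimitive (s * normRatio s θ) * Real.sin θ
          * ((2 * Real.cos θ ^ 2 - Real.sin θ ^ 2) * normRatio s θ ^ 2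
            - 3 * (1 - (2 - s) ^ 2) * Real.sin θ ^ 2 * Real.cos θ ^ 2) / normRatio s θ ^ 5) θ := by
  have hκ := (normRatio_pos hs θ).ne'
  have hnorm := hasDerivAt_normRatio_right hs θ
  have hprim := (hasDerivAt_sinSqPrimitive _).comp θ (hnorm.const_mul s)
  refine ((hprim.fun_mul ((Real.hasDerivAt_cos θ).fun_mul ((Real.hasDerivAt_sin θ).fun_pow 2))
    ).fun_div (hnorm.fun_pow 3) (pow_ne_zero 3 hκ)).fun_neg.congr_deriv ?_
  simp only [Function.comp]
  field_simp
  push_cast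
  ring

theorem deriv_radialFlux_add_deriv_polarFlux {s : ℝ} (hs : s < 2) (θ : ℝ) :
    deriv (fun s => radialFlux s θ) s + deriv (polarFlux s) θ = degreeDensity s θ := by
  have hκ := (normRatio_pos hs θ).ne'
  have hκsq := sq_normRatio s θ
  have htrig := Real.sin_sq_add_cos_sq θ
  rw [(hasDerivAt_radialFlux hs θ).deriv, (hasDerivAt_polarFlux hs θ).deriv, degreeDensity]
  generalize normRatio s θ = κ at *
  generalize Real.sin (π * (s * κ)) = S
  generalize sinSqPrimitive (s * κ) = G
  generalize Real.sin θ = y at *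
  generalize Real.cos θ = x at *
  have hprim : κ ^ 2 - 3 * (2 - s) ^ 2 * x ^ 2 + ((2 * x ^ 2 - y ^ 2) * κ ^ 2
      - 3 * (1 - (2 - s) ^ 2) * y ^ 2 * x ^ 2) = 0 := by
    rw [hκsq]
    linear_combination (2 * (2 - s) ^ 2 * x ^ 2 - y ^ 2) * htrig
  have hsin : (2 - s) * (κ ^ 2 - s * (2 - s) * x ^ 2) - s * (1 - (2 - s) ^ 2) * y ^ 2 * x ^ 2
      = κ ^ 2 * ((2 - s) - s * x ^ 2) := by
    rw [hκsq]
    linear_combination s * (2 - s) ^ 2 * x ^ 2 * htrig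
  field_simp
  linear_combination y * (S ^ 2 * κ * hsin - G * hprim)

theorem radialFlux_zero_left (θ : ℝ) : radialFlux 0 θ = 0 := by
  simp [radialFlux, sinSqPrimitive]

theorem radialFlux_one_left (θ : ℝ) : radialFlux 1 θ = Real.sin θ / 2 := by
  have hκ : normRatio 1 θ = 1 := by norm_num [normRatio]
  have hprim : sinSqPrimitive 1 = 1 / 2 := by simp [sinSqPrimitive]
  rw [radialFlux, hκ, mul_one, hprim]
  ring

theorem polarFlux_zero_right (s : ℝ) : polarFlux s 0 = 0 := by simp [polarFlux]

theorem polarFlux_pi_right (s : ℝ) : polarFlux s π = 0 := by simp [polarFlux]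

/-- The vector field with components `radialFlux`, `polarFlux` and `0` in the coordinates
`(s, θ, ψ)`. -/
noncomputable def flux (i : Fin 3) (p : Coord3) : ℝ :=
  ![radialFlux (p 0) (p 1), polarFlux (p 0) (p 1), 0] i

theorem differentiableAt_flux (i : Fin 3) {p : Coord3} (hp : p 0 < 2) :
    DifferentiableAt ℝ (flux i) p := by
  have hκ := normRatio_pos hp (p 1)
  have hnorm : DifferentiableAt ℝ (fun p : Coord3 => normRatio (p 0) (p 1)) p :=
    DifferentiableAt.sqrt (by fun_prop) (Real.sqrt_pos.1 hκ).ne'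
  have hprim : DifferentiableAt ℝ
      (fun p : Coord3 => sinSqPrimitive (p 0 * normRatio (p 0) (p 1))) p := by
    unfold sinSqPrimitive
    fun_prop
  match i with
  | 0 | 1 =>
    unfold flux radialFlux polarFlux
    simp only [cons_val]
    fun_prop (disch := positivity)
  | 2 => exact differentiableAt_const (0 : ℝ)

theorem fderiv_apply_single {ι : Type*} [Finite ι] [DecidableEq ι] {f : (ι → ℝ) → ℝ} {p : ι → ℝ}
    (hf : DifferentiableAt ℝ f p) (i : ι) :
    fderiv ℝ f p (Pi.single i 1) = deriv (fun u => f (Function.update p i u)) (p i) :=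
  have := Fintype.ofFinite ι
  (hf.hasFDerivAt.comp_hasDerivAt_of_eq (p i) (hasDerivAt_update p i (p i))
    (Function.update_eq_self i p).symm).deriv.symm

theorem sum_fderiv_flux {p : Coord3} (hp : p 0 < 2) :
    ∑ i, fderiv ℝ (flux i) p (Pi.single i 1) = degreeDensity (p 0) (p 1) := by
  simp only [fun i => fderiv_apply_single (differentiableAt_flux i hp) i, Fin.sum_univ_three]
  simpa [flux] using deriv_radialFlux_add_deriv_polarFlux hp (p 1)

/-- The corner opposite to the origin of the box which the coordinates `(s, θ, ψ)` fill on
`orbitSpace`. -/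
noncomputable def boxCorner : Coord3 := ![1, π, 4 * π]

theorem boxCorner_nonneg : 0 ≤ boxCorner := by
  have := Real.pi_pos
  intro i
  match i with
  | 0 | 1 | 2 => simp [boxCorner, this.le]

theorem lt_two_of_mem_Icc_boxCorner {p : Coord3} (hp : p ∈ Icc 0 boxCorner) : p 0 < 2 :=
  lt_of_le_of_lt (hp.2 0) one_lt_two

theorem integrableOn_degreeDensity :
    IntegrableOn (fun p : Coord3 => degreeDensity (p 0) (p 1)) (Icc 0 boxCorner) := by
  have hnorm : Continuous fun p : Coord3 => normRatio (p 0) (p 1) := by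
    unfold normRatio
    fun_prop
  have hdiv : ContinuousOn (fun p : Coord3 => Real.sin (π * (p 0 * normRatio (p 0) (p 1))) ^ 2
      / normRatio (p 0) (p 1) ^ 2) (Icc 0 boxCorner) :=
    ContinuousOn.div (by fun_prop) (hnorm.pow 2).continuousOn fun p hp =>
      pow_ne_zero 2 (normRatio_pos (lt_two_of_mem_Icc_boxCorner hp) _).ne'
  exact ((hdiv.mul (by fun_prop)).mul (by fun_prop)).integrableOn_compact isCompact_Icc

theorem integral_face_sin :
    ∫ x in Icc ((0 : Coord3) ∘ (0 : Fin 3).succAbove) (boxCorner ∘ (0 : Fin 3).succAbove),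
      Real.sin (x 0) / 2 = 4 * π := by
  have hsin : ∫ t in Icc 0 π, Real.sin t / 2 = 1 := by
    rw [integral_Icc_eq_integral_Ioc, ← intervalIntegral.integral_of_le Real.pi_pos.le,
      intervalIntegral.integral_div, integral_sin]
    norm_num
  have hone : ∫ _ in Icc 0 (4 * π), (1 : ℝ) = 4 * π := by simp [Real.pi_pos.le]
  have hprod := integral_fintype_prod_eq_prod (𝕜 := ℝ) (E := fun _ : Fin 2 => ℝ)
    (f := ![fun t => Real.sin t / 2, fun _ => 1])
    (μ := fun i => volume.restrict (Icc (((0 : Coord3) ∘ (0 : Fin 3).succAbove) i)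
      ((boxCorner ∘ (0 : Fin 3).succAbove) i)))
  rw [← pi_univ_Icc, volume_pi, Measure.restrict_pi_pi]
  simp only [Fin.prod_univ_two, cons_val, mul_one] at hprod
  exact hprod.trans ((congrArg₂ (· * ·) hsin hone).trans (one_mul _))

theorem integral_degreeDensity :
    ∫ p in Icc 0 boxCorner, degreeDensity (p 0) (p 1) = 4 * π := by
  have hdiv : EqOn (fun p : Coord3 => ∑ i, fderiv ℝ (flux i) p (Pi.single i 1))
      (fun p => degreeDensity (p 0) (p 1)) (Icc 0 boxCorner) :=
    fun p hp => sum_fderiv_flux (lt_two_of_mem_Icc_boxCorner hp)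
  have hdiff (i : Fin 3) {p : Coord3} (hp : p ∈ Icc 0 boxCorner) : DifferentiableAt ℝ (flux i) p :=
    differentiableAt_flux i (lt_two_of_mem_Icc_boxCorner hp)
  rw [← setIntegral_congr_fun measurableSet_Icc hdiv,
    integral_divergence_of_hasFDerivAt_off_countable' 0 boxCorner boxCorner_nonneg flux
      (fun i => fderiv ℝ (flux i)) ∅ countable_empty
      (fun i p hp => (hdiff i hp).continuousAt.continuousWithinAt)
      (fun p hp i => (hdiff i (pi_univ_Icc 0 boxCorner ▸
        pi_mono (fun _ _ => Ioo_subset_Icc_self) hp.1)).hasFDerivAt)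
      (integrableOn_degreeDensity.congr_fun hdiv.symm measurableSet_Icc)]
  have hfront (x : Fin 2 → ℝ) :
      flux 0 ((0 : Fin 3).insertNth (boxCorner 0) x) = Real.sin (x 0) / 2 := radialFlux_one_left _
  have hback (x : Fin 2 → ℝ) : flux 0 ((0 : Fin 3).insertNth ((0 : Coord3) 0) x) = 0 :=
    radialFlux_zero_left _
  have hsouth (x : Fin 2 → ℝ) : flux 1 ((1 : Fin 3).insertNth (boxCorner 1) x) = 0 :=
    polarFlux_pi_right _
  have hnorth (x : Fin 2 → ℝ) : flux 1 ((1 : Fin 3).insertNth ((0 : Coord3) 1) x) = 0 :=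
    polarFlux_zero_right _
  have hvert (p : Coord3) : flux 2 p = 0 := rfl
  rw [Fin.sum_univ_three]
  simp only [hfront, hback, hsouth, hnorth, hvert, integral_zero, sub_zero, add_zero]
  exact integral_face_sin

/-- The change of coordinates `s = r / (r + 1)`, which makes the range of the radius bounded. -/
noncomputable def compactify (q : Coord3) : Coord3 := ![q 0 / (q 0 + 1), q 1, q 2]

/-- The derivative of `compactify`. -/
noncomputable def compactifyDeriv (q : Coord3) : Coord3 →L[ℝ] Coord3 :=
  ContinuousLinearMap.pi ![(1 / (q 0 + 1) ^ 2) • ContinuousLinearMap.proj 0,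
    ContinuousLinearMap.proj 1, ContinuousLinearMap.proj 2]

theorem hasFDerivAt_compactify {q : Coord3} (hq : q 0 + 1 ≠ 0) :
    HasFDerivAt compactify (compactifyDeriv q) q := by
  refine hasFDerivAt_pi.2 fun i => ?_
  match i with
  | 0 =>
    have hdiv := ((hasDerivAt_id (q 0)).fun_div ((hasDerivAt_id (q 0)).add_const 1) hq).congr_deriv
      (g' := 1 / (q 0 + 1) ^ 2) (by simp)
    exact hdiv.comp_hasFDerivAt (f := fun q : Coord3 => q 0) q (hasFDerivAt_apply 0 q)
  | 1 | 2 => exact hasFDerivAt_apply _ q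

theorem det_compactifyDeriv (q : Coord3) : (compactifyDeriv q).det = 1 / (q 0 + 1) ^ 2 := by
  rw [ContinuousLinearMap.det, ← LinearMap.det_toMatrix', det_fin_three]
  simp [LinearMap.toMatrix'_apply, compactifyDeriv]

theorem injOn_compactify : InjOn compactify {q | q 0 + 1 ≠ 0} := by
  intro p hp q hq h
  have h0 : p 0 / (p 0 + 1) = q 0 / (q 0 + 1) := congrFun h 0
  ext i
  match i with
  | 0 =>
    rw [div_eq_div_iff hp hq] at h0
    linarith
  | 1 => exact congrFun h 1
  | 2 => exact congrFun h 2

theorem image_compactify :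
    compactify '' orbitSpace = univ.pi fun i => Ioo ((0 : Coord3) i) (boxCorner i) := by
  ext p
  simp only [mem_image, mem_univ_pi]
  constructor
  · rintro ⟨q, ⟨hr, hθ, hψ⟩, rfl⟩ i
    match i with
    | 0 => exact ⟨by simp only [compactify, cons_val, Pi.zero_apply]; positivity,
        (div_lt_one (by positivity)).2 (lt_add_one _)⟩
    | 1 => exact hθ
    | 2 => exact hψ
  · intro h
    obtain ⟨h0, h1⟩ : 0 < p 0 ∧ p 0 < 1 := h 0
    refine ⟨![p 0 / (1 - p 0), p 1, p 2], ⟨div_pos h0 (sub_pos.2 h1), h 1, h 2⟩, ?_⟩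
    have : 1 - p 0 ≠ 0 := (sub_pos.2 h1).ne'
    ext i
    match i with
    | 0 =>
      simp only [compactify, cons_val]
      field_simp
      ring
    | 1 | 2 => rfl

theorem injOn_compactify_orbitSpace : InjOn compactify orbitSpace :=
  injOn_compactify.mono fun _ hq => (add_pos hq.1 one_pos).ne'

theorem integrableOn_comp_compactify {f : Coord3 → ℝ} (hf : IntegrableOn f (Icc 0 boxCorner)) :
    IntegrableOn (fun q : Coord3 => 1 / (q 0 + 1) ^ 2 * f (compactify q)) orbitSpace := by
  have h := (integrableOn_image_iff_integrableOn_abs_det_fderiv_smul volume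
    isOpen_orbitSpace.measurableSet (fun q hq => (hasFDerivAt_compactify
      (add_pos hq.1 one_pos).ne').hasFDerivWithinAt) injOn_compactify_orbitSpace f).1
    (image_compactify ▸ hf.congr_set_ae Measure.univ_pi_Ioo_ae_eq_Icc)
  simpa [det_compactifyDeriv] using h

theorem setIntegral_comp_compactify (f : Coord3 → ℝ) :
    ∫ q in orbitSpace, 1 / (q 0 + 1) ^ 2 * f (compactify q) = ∫ p in Icc 0 boxCorner, f p := by
  have h := integral_image_eq_integral_abs_det_fderiv_smul volume isOpen_orbitSpace.measurableSet
    (fun q hq => (hasFDerivAt_compactify (add_pos hq.1 one_pos).ne').hasFDerivWithinAt)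
    injOn_compactify_orbitSpace f
  have hbox : compactify '' orbitSpace =ᵐ[volume] Icc 0 boxCorner :=
    image_compactify ▸ Measure.univ_pi_Ioo_ae_eq_Icc
  simpa [det_compactifyDeriv] using (h.symm.trans (setIntegral_congr_set hbox))

theorem integrableOn_traceCube : IntegrableOn (traceCube skyrmeField) orbitSpace :=
  IntegrableOn.congr_fun
    ((integrableOn_comp_compactify integrableOn_degreeDensity).const_mul (-12 * π)).ofReal
    (fun _ hq => (traceCube_skyrmeField hq.1).symm) isOpen_orbitSpace.measurableSet

theorem degree_skyrmeField : degree skyrmeField = 2 := by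
  have hint : ∫ q in orbitSpace,
      1 / (q 0 + 1) ^ 2 * degreeDensity (q 0 / (q 0 + 1)) (q 1) = 4 * π :=
    (setIntegral_comp_compactify _).trans integral_degreeDensity
  rw [degree, setIntegral_congr_fun isOpen_orbitSpace.measurableSet
    (fun _ hq => traceCube_skyrmeField hq.1), integral_complex_ofReal, integral_const_mul, hint]
  have hπ : (π : ℂ) ≠ 0 := by exact_mod_cast Real.pi_ne_zero
  push_cast
  field_simp
  norm_num

end TaubNUT

theorem mainTheorem2 :
    -- the tetrad is orthonormal for the Taub-NUT metric, and the `ηⱼ` are left-invariant on `SU(2)`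
    (∀ x ∈ TaubNUT.chart, ∀ v : TaubNUT.Coord4,
      ∑ a, (TaubNUT.tetrad a x v) ^ 2 = TaubNUT.metric x v) ∧
    (∀ x v : TaubNUT.Coord4, ∀ a b : Fin 2,
      HasDerivAt (fun s : ℝ => TaubNUT.eulerMap (x + s • v) a b)
        ((TaubNUT.eulerMap x * ∑ j, ((TaubNUT.eta j x v : ℝ) : ℂ) • TaubNUT.gen j) a b) 0) ∧
    -- the self-dual spin connection exists and is unique
    (∃ γ, TaubNUT.IsSelfDualSpinConnection γ) ∧
    (∀ γ γ', TaubNUT.IsSelfDualSpinConnection γ → TaubNUT.IsSelfDualSpinConnection γ' →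
      ∀ x ∈ TaubNUT.chart, ∀ i j, γ i j x = γ' i j x) ∧
    -- its holonomy along the orbits of `∂/∂φ` is the Skyrme field
    (∀ γ, TaubNUT.IsSelfDualSpinConnection γ →
      (∀ x ∈ TaubNUT.chart, ∀ i,
        TaubNUT.potentialComponent γ i x (TaubNUT.partialVec 2)
          = TaubNUT.profile i (x 0) * TaubNUT.unitVec i (x 1) (x 3)) ∧
      (∀ q ∈ TaubNUT.orbitSpace,
        TaubNUT.IsHolonomy (TaubNUT.potential γ) q (TaubNUT.skyrmeField q))) ∧
    -- it is a smooth `SU(2)`-valued map of degree two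
    (∀ q, TaubNUT.skyrmeField q ∈ Matrix.specialUnitaryGroup (Fin 2) ℂ) ∧
    (∀ a b : Fin 2, ContDiffOn ℝ (⊤ : ℕ∞) (fun q => TaubNUT.skyrmeField q a b)
      TaubNUT.orbitSpace) ∧
    MeasureTheory.IntegrableOn (TaubNUT.traceCube TaubNUT.skyrmeField) TaubNUT.orbitSpace ∧
    TaubNUT.degree TaubNUT.skyrmeField = 2 := by
  refine ⟨fun x hx v => TaubNUT.sum_tetrad_sq hx v, TaubNUT.hasDerivAt_eulerMap,
    ⟨_, TaubNUT.isSelfDualSpinConnection_spinConnection⟩,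
    fun γ γ' h h' x hx i j => h.unique h' hx i j,
    fun γ h => ⟨fun x hx i => h.potentialComponent_partialVec hx i, fun q hq => h.isHolonomy hq⟩,
    TaubNUT.skyrmeField_mem_specialUnitaryGroup, TaubNUT.contDiffOn_skyrmeField,
    TaubNUT.integrableOn_traceCube, TaubNUT.degree_skyrmeField⟩
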